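/- Let $n\in\mathbb N$, $T>0$, $\mathcal H=L^2([0,T];\mathbb C^{2n})$, $J=\begin{pmatrix}0&-I_n\\ I_n&0\end{pmatrix}$, and let $e_1,\dots,e_{2n}$ be the standard basis of $\mathbb R^{2n}$. Let $-\pi/2<\theta_j\le\pi/2$ for $1\le j\le n$, and let $V_0,V_1$ be the Lagrangian subspaces of $\mathbb R^{2n}$ with frames $Z_0=(I_n,0_n)^T$ and $Z_1=(C(\theta),S(\theta))^T$, where $C(\theta)=\mathrm{diag}(\cos\theta_1,\dots,\cos\theta_n)$ and $S(\theta)=\mathrm{diag}(\sin\theta_1,\dots,\sin\theta_n)$. Let $A=-J\frac{d}{dt}$ be the unbounded operator on $\mathcal H$ with domain $$\{z\in W^{1,2}([0,T];\mathbb C^{2n}) : z(0)\in V_0\otimes\mathbb C,\ z(T)\in V_1\otimes\mathbb C\}.$$ A continuous path $B$ of real symmetric $2n\times 2n$ matrices on $[0,T]$ acts on $\mathcal H$ by $(Bz)(t)=B(t)z(t)$. For bounded operators $B,D$ on $\mathcal H$ such that $A-B$ is invertible (that is, has a bounded inverse), put $\mathcal F(B,D)=D(A-B)^{-1}$; for $\nu\in\mathbb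 C$, $\mathcal F(\nu,D)$ means $\mathcal F(\nu\cdot\mathrm{id},D)$. For $k\in\mathbb Z$ put $\lambda_{j,k}=\theta_j/T+k\pi/T$ and $e_{j,k}(t)=e^{\lambda_{j,k}Jt}e_j=\cos(\lambda_{j,k}t)e_j+\sin(\lambda_{j,k}t)e_{n+j}$ (eigenvalues and eigenvectors of $A$). For $N\ge 0$ let $P_N$ be the orthogonal projection of $\mathcal H$ onto $\mathrm{span}\{e_{j,k} : 1\le j\le n,\ |k|\le N\}$. For a sequence $(P_N)$ of finite rank projections with increasing ranges that converges strongly to the identity, $\mathcal J(P_N)$ (the trace finite condition) is the set of Hilbert–Schmidt operators $F$ for which $\lim_{N\to\infty}\mathrm{Tr}(P_NFP_N)$ exists in $\mathbb C$. This limit is the conditional trace $\mathrm{Tr}\,F$, and the conditional Fredholm determinant is $\det(\mathrm{id}+F)=\lim_{N\to\infty}\det(\mathrm{id}+P_NFP_N)$. Then the $P_N$ are a sequence of finite rank projections with increasing ranges that converges strongly to the identity, and for all continuous paths $B,D$ of real symmetric $2n\times2n$ matrices on $[0,T]$ the following hold. (i) For every $\nu\in\mathbb C$ such that $A-\nu$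 is invertible, $\mathcal F(\nu,D)\in\mathcal J(P_N)$ and $$\mathrm{Tr}\,\mathcal F(\nu,D)=\sum_{j=1}^n\frac{\cos(\theta_j-T\nu)}{\sin(\theta_j-T\nu)}\int_0^T\bigl(e^{-\nu Jt}D(t)e^{\nu Jt}\bigr)_{j,j}\,dt+\sum_{j=1}^n\int_0^T\bigl(e^{-\nu Jt}D(t)e^{\nu Jt}\bigr)_{j,\,n+j}\,dt .$$ (ii) If $A-B$ is invertible, then $\mathcal F(B,D)\in\mathcal J(P_N)$, and the conditional Fredholm determinant $\det(\mathrm{id}-\mathcal F(B,D))$ is well defined: the limit $\lim_{N\to\infty}\det(\mathrm{id}-P_N\mathcal F(B,D)P_N)$ exists in $\mathbb C$. -/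

import Mathlib

open MeasureTheory Filter Topology

noncomputable section

namespace LagHam

/-! ## Conditional trace and conditional determinant along a sequence of projections -/

section Conditional

variable {H : Type*} [NormedAddCommGroup H] [InnerProductSpace ℂ H]

/-- `F` is a Hilbert-Schmidt operator: `∑ ‖F eᵢ‖²` converges for a Hilbert basis `(eᵢ)`. -/
def IsHilbertSchmidt (F : H →L[ℂ] H) : Prop :=
  ∃ (s : Set H) (b : HilbertBasis s ℂ H), Summable fun i => ‖F (b i)‖ ^ 2

/-- A sequence of finite rank projections with increasing ranges that converges strongly to the
identity. -/
structure IsProjectionSequence (P : ℕ → H →L[ℂ] H) : Prop where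
  idempotent : ∀ k, P k * P k = P k
  finite_rank : ∀ k, FiniteDimensional ℂ (P k : H →ₗ[ℂ] H).range
  range_mono : ∀ k m, k ≤ m → (P k : H →ₗ[ℂ] H).range ≤ (P m : H →ₗ[ℂ] H).range
  strong_limit : ∀ x, Tendsto (fun k => P k x) atTop (𝓝 x)

/-- The operator `P F P`, regarded as an endomorphism of the range of `P`. -/
def compression (P F : H →L[ℂ] H) :
    (P : H →ₗ[ℂ] H).range →ₗ[ℂ] (P : H →ₗ[ℂ] H).range :=
  (P : H →ₗ[ℂ] H).rangeRestrict ∘ₗ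
    ((F ∘L P : H →L[ℂ] H) : H →ₗ[ℂ] H) ∘ₗ (P : H →ₗ[ℂ] H).range.subtype

/-- `Tr (P F P)` for a finite rank projection `P`. -/
def compressedTrace (P F : H →L[ℂ] H) : ℂ :=
  LinearMap.trace ℂ _ (compression P F)

/-- `det (id + P F P)` for a finite rank projection `P`; the operator `id + P F P` is block
triangular with the identity on the complement of the range of `P`, so that its determinant is
the determinant of its restriction to the range. -/
def compressedDet (P F : H →L[ℂ] H) : ℂ :=
  LinearMap.det (LinearMap.id + compression P F)

/-- `c` is the conditional trace of `F` along `(Pₖ)`. -/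
def HasConditionalTrace (P : ℕ → H →L[ℂ] H) (F : H →L[ℂ] H) (c : ℂ) : Prop :=
  Tendsto (fun k => compressedTrace (P k) F) atTop (𝓝 c)

/-- The set of operators that satisfy the trace finite condition with respect to `(Pₖ)`. -/
def traceFinite (P : ℕ → H →L[ℂ] H) : Set (H →L[ℂ] H) :=
  {F | IsHilbertSchmidt F ∧ ∃ c : ℂ, HasConditionalTrace P F c}

/-- `d` is the conditional Fredholm determinant `det (id + F)` along `(Pₖ)`. -/
def HasConditionalDet (P : ℕ → H →L[ℂ] H) (F : H →L[ℂ] H) (d : ℂ) : Prop :=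
  Tendsto (fun k => compressedDet (P k) F) atTop (𝓝 d)

/-! ## Bounded inverses of unbounded operators -/

/-- The unbounded operator `A - K` with the domain of `A`, for a bounded `K`. -/
def subBounded (A : H →ₗ.[ℂ] H) (K : H →L[ℂ] H) : H →ₗ.[ℂ] H where
  domain := A.domain
  toFun := A.toFun - (K : H →ₗ[ℂ] H) ∘ₗ A.domain.subtype

/-- The bounded operator `R` is a two-sided inverse of `S : dom S → H`. -/
def IsBoundedInverse (S : H →ₗ.[ℂ] H) (R : H →L[ℂ] H) : Prop :=
  (∀ y, ∃ h : R y ∈ S.domain, S ⟨R y, h⟩ = y) ∧ ∀ x : S.domain, R (S x) = x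

/-- `S : dom S → H` has a bounded inverse. -/
def IsInvertible (S : H →ₗ.[ℂ] H) : Prop := ∃ R, IsBoundedInverse S R

open Classical in
/-- The bounded inverse of an invertible operator (and `0` if `S` is not invertible). -/
def boundedInverse (S : H →ₗ.[ℂ] H) : H →L[ℂ] H :=
  if h : IsInvertible S then h.choose else 0

theorem IsBoundedInverse.unique {S : H →ₗ.[ℂ] H} {R R' : H →L[ℂ] H}
    (h : IsBoundedInverse S R) (h' : IsBoundedInverse S R') : R = R' := by
  ext y
  obtain ⟨hy, hS⟩ := h.1 y
  have := h'.2 ⟨R y, hy⟩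
  rw [hS] at this
  exact this.symm

theorem isBoundedInverse_boundedInverse {S : H →ₗ.[ℂ] H} (h : IsInvertible S) :
    IsBoundedInverse S (boundedInverse S) := by
  rw [boundedInverse, dif_pos h]
  exact h.choose_spec

end Conditional

/-! ## The Hilbert space and its multiplication operators -/

/-- The phase space `ℂ²ⁿ` with its Hermitian norm; `Sum.inl j` is the coordinate `j` and
`Sum.inr j` the coordinate `n + j`. -/
abbrev Phase (n : ℕ) : Type := EuclideanSpace ℂ (Fin n ⊕ Fin n)

/-- Lebesgue measure on `[0, T]`. -/
abbrev vol (T : ℝ) : Measure ℝ := volume.restrict (Set.Icc 0 T)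

/-- The Hilbert space `L²([0, T]; ℂ²ⁿ)`. -/
abbrev L2 (n : ℕ) (T : ℝ) : Type := Lp (Phase n) 2 (vol T)

/-- A real matrix of size `2n` as an operator on `ℂ²ⁿ`. -/
def matOp {n : ℕ} (M : Matrix (Fin n ⊕ Fin n) (Fin n ⊕ Fin n) ℝ) : Phase n →L[ℂ] Phase n :=
  Matrix.toEuclideanCLM (n := Fin n ⊕ Fin n) (𝕜 := ℂ) (M.map Complex.ofReal)

theorem continuous_matOp {n : ℕ} :
    Continuous (matOp : Matrix (Fin n ⊕ Fin n) (Fin n ⊕ Fin n) ℝ → Phase n →L[ℂ] Phase n) := by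
  have h : Continuous ((Matrix.toEuclideanCLM (n := Fin n ⊕ Fin n) (𝕜 := ℂ)) :
      Matrix (Fin n ⊕ Fin n) (Fin n ⊕ Fin n) ℂ → Phase n →L[ℂ] Phase n) :=
    LinearMap.continuous_of_finiteDimensional
      { toFun := Matrix.toEuclideanCLM (n := Fin n ⊕ Fin n) (𝕜 := ℂ)
        map_add' := fun x y => map_add _ x y
        map_smul' := fun c x => map_smul _ c x }
  exact h.comp (continuous_id.matrix_map Complex.continuous_ofReal)

theorem exists_bound_matOp {n : ℕ} {T : ℝ} {M : ℝ → Matrix (Fin n ⊕ Fin n) (Fin n ⊕ Fin n) ℝ}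
    (hM : ContinuousOn M (Set.Icc 0 T)) :
    ∃ C : ℝ, ∀ t ∈ Set.Icc 0 T, ‖matOp (M t)‖ ≤ C :=
  isCompact_Icc.exists_bound_of_continuousOn (continuous_matOp.comp_continuousOn hM)

theorem ae_norm_matOp_le {n : ℕ} {T : ℝ} {M : ℝ → Matrix (Fin n ⊕ Fin n) (Fin n ⊕ Fin n) ℝ}
    {C : ℝ} (hC : ∀ t ∈ Set.Icc 0 T, ‖matOp (M t)‖ ≤ C) (f : ℝ → Phase n) :
    ∀ᵐ t ∂(vol T), ‖matOp (M t) (f t)‖ ≤ C * ‖f t‖ := by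
  filter_upwards [ae_restrict_mem measurableSet_Icc] with t ht
  exact (matOp (M t)).le_of_opNorm_le (hC t ht) _

theorem memLp_matOp {n : ℕ} {T : ℝ} {M : ℝ → Matrix (Fin n ⊕ Fin n) (Fin n ⊕ Fin n) ℝ}
    (hM : ContinuousOn M (Set.Icc 0 T)) (f : L2 n T) :
    MemLp (fun t => matOp (M t) (f t)) 2 (vol T) := by
  obtain ⟨C, hC⟩ := exists_bound_matOp hM
  refine (Lp.memLp f).of_le_mul (c := C) ?_ (ae_norm_matOp_le hC f)
  have h1 : AEStronglyMeasurable (fun t => matOp (M t)) (vol T) :=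
    (continuous_matOp.comp_continuousOn hM).aestronglyMeasurable measurableSet_Icc
  exact (isBoundedBilinearMap_apply (𝕜 := ℂ)).continuous.comp_aestronglyMeasurable
    (h1.prodMk (Lp.aestronglyMeasurable f))

/-- The bounded operator `(M f)(t) = M(t) f(t)` on `L²([0, T]; ℂ²ⁿ)` for a continuous path `M` of
real matrices. -/
def mulOp {n : ℕ} {T : ℝ} (M : ℝ → Matrix (Fin n ⊕ Fin n) (Fin n ⊕ Fin n) ℝ)
    (hM : ContinuousOn M (Set.Icc 0 T)) : L2 n T →L[ℂ] L2 n T :=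
  LinearMap.mkContinuousOfExistsBound
    { toFun := fun f => (memLp_matOp hM f).toLp _
      map_add' := fun f g => by
        apply Lp.ext
        filter_upwards [(memLp_matOp hM (f + g)).coeFn_toLp, (memLp_matOp hM f).coeFn_toLp,
          (memLp_matOp hM g).coeFn_toLp, Lp.coeFn_add f g,
          Lp.coeFn_add ((memLp_matOp hM f).toLp _) ((memLp_matOp hM g).toLp _)]
          with t h1 h2 h3 h4 h5
        rw [h1, h5, Pi.add_apply, h2, h3, h4, Pi.add_apply, map_add]
      map_smul' := fun c f => by
        apply Lp.ext
        filter_upwards [(memLp_matOp hM (c • f)).coeFn_toLp, (memLp_matOp hM f).coeFn_toLp,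
          Lp.coeFn_smul c f, Lp.coeFn_smul c ((memLp_matOp hM f).toLp _)] with t h1 h2 h3 h4
        rw [h1, RingHom.id_apply, h4, Pi.smul_apply, h2, h3, Pi.smul_apply, map_smul] }
    (by
      obtain ⟨C, hC⟩ := exists_bound_matOp hM
      refine ⟨C, fun f => Lp.norm_le_mul_norm_of_ae_le_mul ?_⟩
      filter_upwards [(memLp_matOp hM f).coeFn_toLp, ae_norm_matOp_le hC f] with t h1 h2
      change ‖((memLp_matOp hM f).toLp _ : ℝ → Phase n) t‖ ≤ _
      rw [h1]
      exact h2)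

theorem coeFn_mulOp {n : ℕ} {T : ℝ} (M : ℝ → Matrix (Fin n ⊕ Fin n) (Fin n ⊕ Fin n) ℝ)
    (hM : ContinuousOn M (Set.Icc 0 T)) (f : L2 n T) :
    mulOp M hM f =ᵐ[vol T] fun t => matOp (M t) (f t) :=
  (memLp_matOp hM f).coeFn_toLp

/-! ## The operator `-J d/dt` with separated boundary conditions -/

/-- `u` on `[0, T]` is absolutely continuous with derivative `g ∈ L²`, that is, `u` is the
continuous representative of an element of `W^{1,2}([0, T]; ℂ²ⁿ)` with weak derivative `g`. -/
def IsPrimitive {n : ℕ} {T : ℝ} (u : ℝ → Phase n) (g : L2 n T) : Prop :=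
  ∀ t ∈ Set.Icc 0 T, u t = u 0 + ∫ s in 0..t, g s

theorem intervalIntegrable_L2 {n : ℕ} {T : ℝ} (g : L2 n T) {t : ℝ} (ht : t ∈ Set.Icc 0 T) :
    IntervalIntegrable g volume 0 t := by
  have h : IntegrableOn g (Set.Icc 0 T) volume := (Lp.memLp g).integrable (by norm_num)
  rw [intervalIntegrable_iff_integrableOn_Ioc_of_le ht.1]
  exact h.mono_set (fun s hs => ⟨hs.1.le, hs.2.trans ht.2⟩)

theorem IsPrimitive.add {n : ℕ} {T : ℝ} {u v : ℝ → Phase n} {g h : L2 n T}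
    (hu : IsPrimitive u g) (hv : IsPrimitive v h) : IsPrimitive (u + v) (g + h) := by
  intro t ht
  have hadd : ∫ s in 0..t, (g + h : L2 n T) s = ∫ s in 0..t, (g s + h s) := by
    apply intervalIntegral.integral_congr_ae
    have := (ae_restrict_iff' measurableSet_Icc).1 (Lp.coeFn_add g h)
    filter_upwards [this] with s hs hst
    rw [Set.uIoc_of_le ht.1] at hst
    exact hs ⟨hst.1.le, hst.2.trans ht.2⟩
  rw [hadd, intervalIntegral.integral_add (intervalIntegrable_L2 g ht)
    (intervalIntegrable_L2 h ht), Pi.add_apply, Pi.add_apply, hu t ht, hv t ht]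
  abel

theorem IsPrimitive.smul {n : ℕ} {T : ℝ} {u : ℝ → Phase n} {g : L2 n T} (c : ℂ)
    (hu : IsPrimitive u g) : IsPrimitive (c • u) (c • g) := by
  intro t ht
  have hsmul : ∫ s in 0..t, (c • g : L2 n T) s = ∫ s in 0..t, c • g s := by
    apply intervalIntegral.integral_congr_ae
    have := (ae_restrict_iff' measurableSet_Icc).1 (Lp.coeFn_smul c g)
    filter_upwards [this] with s hs hst
    rw [Set.uIoc_of_le ht.1] at hst
    exact hs ⟨hst.1.le, hst.2.trans ht.2⟩
  rw [hsmul, intervalIntegral.integral_smul, Pi.smul_apply, Pi.smul_apply, hu t ht, smul_add]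

theorem isPrimitive_zero {n : ℕ} {T : ℝ} : IsPrimitive (0 : ℝ → Phase n) (0 : L2 n T) := by
  intro t ht
  have h0 : ∫ s in 0..t, (0 : L2 n T) s = ∫ _s in 0..t, (0 : Phase n) := by
    apply intervalIntegral.integral_congr_ae
    have := (ae_restrict_iff' measurableSet_Icc).1 (Lp.coeFn_zero (Phase n) 2 (vol T))
    filter_upwards [this] with s hs hst
    rw [Set.uIoc_of_le ht.1] at hst
    exact hs ⟨hst.1.le, hst.2.trans ht.2⟩
  rw [h0]
  simp

theorem IsPrimitive.eq_zero {n : ℕ} {T : ℝ} {u : ℝ → Phase n} {g : L2 n T}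
    (hT : 0 < T) (hu : IsPrimitive u g) (h0 : u =ᵐ[vol T] 0) : g = 0 := by
  have hT' : T ∈ Set.Icc 0 T := ⟨hT.le, le_rfl⟩
  have hint := intervalIntegrable_L2 g hT'
  have hcont : ContinuousOn u (Set.Icc 0 T) := by
    have h1 : ContinuousOn (fun t => ∫ s in 0..t, g s) (Set.Icc 0 T) := by
      have := intervalIntegral.continuousOn_primitive_interval'
        (μ := volume) (f := (g : ℝ → Phase n)) hint Set.left_mem_uIcc
      rwa [Set.uIcc_of_le hT.le] at this
    exact (continuousOn_const.add h1).congr hu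
  have hzero : Set.EqOn u 0 (Set.Icc 0 T) :=
    Measure.eqOn_Icc_of_ae_eq volume hT.ne h0 hcont continuousOn_const
  have hprim : ∀ t ∈ Set.Icc 0 T, ∫ s in 0..t, g s = 0 := by
    intro t ht
    have h1 := hu t ht
    rw [hzero ht, hzero ⟨le_rfl, hT.le⟩] at h1
    simpa using h1.symm
  apply Lp.ext
  have hd := ae_restrict_of_ae (s := Set.Ioo 0 T) hint.ae_hasDerivAt_integral
  have hIoo : vol T = volume.restrict (Set.Ioo 0 T) :=
    Measure.restrict_congr_set Ioo_ae_eq_Icc.symm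
  have key : ∀ᵐ x ∂(volume.restrict (Set.Ioo 0 T)), g x = 0 := by
    filter_upwards [hd, ae_restrict_mem measurableSet_Ioo] with x hx hmem
    rw [Set.uIcc_of_le hT.le] at hx
    have h1 := hx ⟨hmem.1.le, hmem.2.le⟩ 0 ⟨le_rfl, hT.le⟩
    have h2 : (fun x => ∫ s in 0..x, g s) =ᶠ[𝓝 x] fun _ => 0 := by
      filter_upwards [Ioo_mem_nhds hmem.1 hmem.2] with y hy
      exact hprim y ⟨hy.1.le, hy.2.le⟩
    exact h1.unique ((hasDerivAt_const x (0 : Phase n)).congr_of_eventuallyEq h2)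
  rw [← hIoo] at key
  filter_upwards [key, Lp.coeFn_zero (Phase n) 2 (vol T)] with x h1 h2
  rw [h1, h2, Pi.zero_apply]

/-- The complexification of the real subspace of `ℝ²ⁿ` that is spanned by the columns of the
frame `Z`. -/
def frameSpace {n : ℕ} (Z : Matrix (Fin n ⊕ Fin n) (Fin n) ℝ) : Submodule ℂ (Phase n) :=
  Submodule.span ℂ (Set.range fun j : Fin n => WithLp.toLp 2 fun i => (Z i j : ℂ))

/-- The operator of multiplication by `J = (0, -I; I, 0)` on `L²([0, T]; ℂ²ⁿ)`. -/
def opJ (n : ℕ) (T : ℝ) : L2 n T →L[ℂ] L2 n T :=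
  mulOp (fun _ => Matrix.J (Fin n) ℝ) continuousOn_const

/-- The graph of `-J d/dt` on the domain
`{z ∈ W^{1,2}([0, T]; ℂ²ⁿ) | z(0) ∈ V₀, z(T) ∈ V₁}`. -/
def hamGraph {n : ℕ} (T : ℝ) (V₀ V₁ : Submodule ℂ (Phase n)) :
    Submodule ℂ (L2 n T × L2 n T) where
  carrier := {p | ∃ (u : ℝ → Phase n) (g : L2 n T),
    p.1 =ᵐ[vol T] u ∧ IsPrimitive u g ∧ u 0 ∈ V₀ ∧ u T ∈ V₁ ∧ p.2 = -opJ n T g}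
  add_mem' := by
    rintro p q ⟨u, g, h1, h2, h3, h4, h5⟩ ⟨v, h, k1, k2, k3, k4, k5⟩
    refine ⟨u + v, g + h, ?_, h2.add k2, V₀.add_mem h3 k3, V₁.add_mem h4 k4, ?_⟩
    · exact (Lp.coeFn_add p.1 q.1).trans (h1.add k1)
    · rw [Prod.snd_add, h5, k5, map_add, neg_add]
  zero_mem' := by
    refine ⟨0, 0, Lp.coeFn_zero _ _ _, isPrimitive_zero, V₀.zero_mem, V₁.zero_mem, ?_⟩
    simp
  smul_mem' := by
    rintro c p ⟨u, g, h1, h2, h3, h4, h5⟩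
    refine ⟨c • u, c • g, ?_, h2.smul c, V₀.smul_mem c h3, V₁.smul_mem c h4, ?_⟩
    · exact (Lp.coeFn_smul c p.1).trans (h1.const_smul c)
    · rw [Prod.smul_snd, h5, map_smul, smul_neg]

/-- The unbounded operator `A = -J d/dt` on `L²([0, T]; ℂ²ⁿ)` with domain
`{z ∈ W^{1,2}([0, T]; ℂ²ⁿ) | z(0) ∈ V₀, z(T) ∈ V₁}`. -/
def hamOp {n : ℕ} (T : ℝ) (V₀ V₁ : Submodule ℂ (Phase n)) : L2 n T →ₗ.[ℂ] L2 n T :=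
  (hamGraph T V₀ V₁).toLinearPMap

theorem hamOp_graph {n : ℕ} {T : ℝ} (hT : 0 < T) (V₀ V₁ : Submodule ℂ (Phase n)) :
    (hamOp T V₀ V₁).graph = hamGraph T V₀ V₁ := by
  apply Submodule.toLinearPMap_graph_eq
  rintro ⟨z, w⟩ ⟨u, g, h1, h2, -, -, h5⟩ hz
  have hz' : z = 0 := hz
  subst hz'
  have hg : g = 0 := h2.eq_zero hT (h1.symm.trans (Lp.coeFn_zero _ _ _))
  have hw : w = -opJ n T g := h5
  change w = 0
  rw [hw, hg, map_zero, neg_zero]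

/-- The operator `𝓕(K, D) = D (A - K)⁻¹` for bounded operators `K` and `D`. -/
def calF {n : ℕ} {T : ℝ} (A : L2 n T →ₗ.[ℂ] L2 n T) (K D : L2 n T →L[ℂ] L2 n T) :
    L2 n T →L[ℂ] L2 n T :=
  D ∘L boundedInverse (subBounded A K)

/-! ## The normal form of the boundary conditions and the eigenprojections -/

/-- The Lagrangian frame `(I, 0)ᵀ`. -/
def frameZero (n : ℕ) : Matrix (Fin n ⊕ Fin n) (Fin n) ℝ := Matrix.fromRows 1 0

/-- The Lagrangian frame `(C(θ), S(θ))ᵀ`, where `C(θ)` and `S(θ)` are the diagonal matrices of the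
`cos θⱼ` and the `sin θⱼ`. -/
def frameOne {n : ℕ} (θ : Fin n → ℝ) : Matrix (Fin n ⊕ Fin n) (Fin n) ℝ :=
  Matrix.fromRows (Matrix.diagonal fun j => Real.cos (θ j))
    (Matrix.diagonal fun j => Real.sin (θ j))

/-- The operator `A` for the boundary conditions in normal form. -/
def normalA {n : ℕ} (T : ℝ) (θ : Fin n → ℝ) : L2 n T →ₗ.[ℂ] L2 n T :=
  hamOp T (frameSpace (frameZero n)) (frameSpace (frameOne θ))

/-- The eigenvalue `λ_{j,k} = θⱼ / T + k π / T` of `A`. -/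
def eigVal {n : ℕ} (T : ℝ) (θ : Fin n → ℝ) (j : Fin n) (k : ℤ) : ℝ :=
  θ j / T + k * Real.pi / T

/-- The eigenfunction
`e_{j,k}(t) = exp(λ_{j,k} J t) e_j = cos(λ_{j,k} t) e_j + sin(λ_{j,k} t) e_{n+j}` of `A`. -/
def eigFun {n : ℕ} (T : ℝ) (θ : Fin n → ℝ) (j : Fin n) (k : ℤ) (t : ℝ) : Phase n :=
  (Real.cos (eigVal T θ j k * t) : ℂ) • EuclideanSpace.single (Sum.inl j) 1 +
    (Real.sin (eigVal T θ j k * t) : ℂ) • EuclideanSpace.single (Sum.inr j) 1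

theorem memLp_eigFun {n : ℕ} (T : ℝ) (θ : Fin n → ℝ) (j : Fin n) (k : ℤ) :
    MemLp (eigFun T θ j k) 2 (vol T) := by
  have hc : Continuous (eigFun T θ j k) := by
    unfold eigFun
    fun_prop
  refine MemLp.of_bound hc.aestronglyMeasurable 2 (Eventually.of_forall fun t => ?_)
  refine (norm_add_le _ _).trans ?_
  rw [norm_smul, norm_smul, Complex.norm_real, Complex.norm_real, PiLp.norm_single,
    PiLp.norm_single, norm_one, mul_one, mul_one, Real.norm_eq_abs, Real.norm_eq_abs]
  linarith [Real.abs_cos_le_one (eigVal T θ j k * t), Real.abs_sin_le_one (eigVal T θ j k * t)]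

/-- The space `span {e_{j,k} | 1 ≤ j ≤ n, |k| ≤ N}`. -/
def eigSpan {n : ℕ} (T : ℝ) (θ : Fin n → ℝ) (N : ℕ) : Submodule ℂ (L2 n T) :=
  Submodule.span ℂ (Set.range fun p : Fin n × Set.Icc (-(N : ℤ)) (N : ℤ) =>
    (memLp_eigFun T θ p.1 (p.2 : ℤ)).toLp (eigFun T θ p.1 (p.2 : ℤ)))

instance {n : ℕ} (T : ℝ) (θ : Fin n → ℝ) (N : ℕ) : FiniteDimensional ℂ (eigSpan T θ N) :=
  FiniteDimensional.span_of_finite ℂ (Set.finite_range _)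

/-- The orthogonal projection `P_N` onto `span {e_{j,k} | 1 ≤ j ≤ n, |k| ≤ N}`. -/
def eigProj {n : ℕ} (T : ℝ) (θ : Fin n → ℝ) (N : ℕ) : L2 n T →L[ℂ] L2 n T :=
  (eigSpan T θ N).starProjection

/-! ## The value of the conditional trace -/

/-- The complex matrix `exp(-νJt) D exp(νJt)`. -/
def conjExp {n : ℕ} (ν : ℂ) (t : ℝ) (D : Matrix (Fin n ⊕ Fin n) (Fin n ⊕ Fin n) ℝ) :
    Matrix (Fin n ⊕ Fin n) (Fin n ⊕ Fin n) ℂ :=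
  NormedSpace.exp ((-(ν * t)) • Matrix.J (Fin n) ℂ) * D.map Complex.ofReal *
    NormedSpace.exp ((ν * t) • Matrix.J (Fin n) ℂ)

end LagHam

end

open LagHam

/-! ## Determinants of finite matrices -/

section FiniteDet

open scoped Matrix.Norms.Frobenius ComplexOrder

variable {m : Type*} [Fintype m] [DecidableEq m]

/-! The normalized `e_{j,k}` form a Hilbert basis of eigenvectors of `A`, and each `P_N` projects
onto finitely many of them. Compressed traces and determinants are therefore diagonal sums and
determinants of finite sections of one infinite matrix.

For a bounded inverse `R` of `A - K` and a number `ν` that is not an eigenvalue, applying `R` to `(A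
- K) b = (λ - ν) b - (K - ν) b` gives `R b = (λ - ν)⁻¹ (b + R (K - ν) b)`
(`boundedInverse_apply_eigBasis`). Since `λ` grows linearly in `k`, the numbers `(λ - ν)⁻¹` are
square summable. Hence `F = D R` is Hilbert-Schmidt. In its diagonal, the correction `(λ - ν)⁻¹ ⟨F*
b, (K - ν) b⟩` is a product of two square summable families, so its sum converges absolutely. Only
the diagonal of `D (A - ν)⁻¹` needs conditional summation. It can be taken at `ν = i`, because the
eigenvalues are real.

That sum is explicit (`tendsto_sum_resolvent_integral`). The form `⟨e^{λJt} e_j, D e^{λJt} e_j⟩` is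
a mean plus multiples of `exp (± 2 i λ t)`. The mean leads to the symmetric sums of `1 / (k + α)`,
which tend to `π cot (π α)`. The oscillating parts are summed absolutely by Parseval and give `π
(cot (π α) ± i)`. The cotangents make up the first sum in the trace formula, and the terms `± i`
make up the second.

For the determinant, `det (1 + M) = regDet M * exp (Tr M)`. The regularized factor is controlled by
the Hilbert-Schmidt norm alone, so it converges for every square summable matrix
(`cauchySeq_regDet`), and the other factor converges by the existence of the conditional trace. -/

theorem Matrix.frobenius_norm_sq (M : Matrix m m ℂ) : ‖M‖ ^ 2 = ∑ i, ∑ j, ‖M i j‖ ^ 2 := by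
  have h : (0 : ℝ) ≤ ∑ i, ∑ j, ‖M i j‖ ^ 2 := by positivity
  rw [Matrix.frobenius_norm_def]
  simp only [Real.rpow_ofNat]
  rw [← Real.sqrt_eq_rpow, Real.sq_sqrt h]

theorem Matrix.trace_conjTranspose_mul_self_eq_norm_sq (M : Matrix m m ℂ) :
    (M.conjTranspose * M).trace = ((‖M‖ ^ 2 : ℝ) : ℂ) := by
  rw [Matrix.frobenius_norm_sq, Matrix.trace, Finset.sum_comm]
  simp [Matrix.mul_apply, Complex.conj_mul']

/-- The eigenvalues `x` of `(1 + M)ᴴ (1 + M)` are nonnegative, have product `|det (1 + M)|²` and sum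
`card m + 2 Re Tr M + ‖M‖²`. Multiplying the inequalities `x ≤ exp (x - 1)` makes the dimension
cancel. -/
theorem Matrix.norm_det_one_add_le (M : Matrix m m ℂ) :
    ‖(1 + M).det‖ ≤ Real.exp (M.trace.re + ‖M‖ ^ 2 / 2) := by
  have hP := Matrix.posSemidef_conjTranspose_mul_self (1 + M)
  set P := (1 + M).conjTranspose * (1 + M) with hPdef
  have hdet : P.det = ((‖(1 + M).det‖ ^ 2 : ℝ) : ℂ) := by
    rw [hPdef, Matrix.det_mul, Matrix.det_conjTranspose]
    simp [Complex.conj_mul']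
  have htr : P.trace = ((Fintype.card m + 2 * M.trace.re + ‖M‖ ^ 2 : ℝ) : ℂ) := by
    have : P = 1 + (M.conjTranspose + M) + M.conjTranspose * M := by
      rw [hPdef, Matrix.conjTranspose_add, Matrix.conjTranspose_one]
      noncomm_ring
    rw [this, Matrix.trace_add, Matrix.trace_add, Matrix.trace_add,
      Matrix.trace_conjTranspose_mul_self_eq_norm_sq, Matrix.trace_one, Matrix.trace_conjTranspose]
    have h2 := Complex.add_conj M.trace
    rw [add_comm] at h2
    simp only [Complex.star_def]
    rw [h2]
    push_cast
    ring
  have h1 : ‖(1 + M).det‖ ^ 2 = ∏ i, hP.1.eigenvalues i := by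
    have := hP.1.det_eq_prod_eigenvalues
    rw [hdet] at this
    exact Complex.ofReal_injective (this.trans (Complex.ofReal_prod _ _).symm)
  have h2 : Fintype.card m + 2 * M.trace.re + ‖M‖ ^ 2 = ∑ i, hP.1.eigenvalues i := by
    have := hP.1.trace_eq_sum_eigenvalues
    rw [htr] at this
    exact Complex.ofReal_injective (this.trans (Complex.ofReal_sum _ _).symm)
  have h3 : ∏ i, hP.1.eigenvalues i ≤ ∏ i, Real.exp (hP.1.eigenvalues i - 1) := by
    apply Finset.prod_le_prod
    · intro i _
      exact hP.eigenvalues_nonneg i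
    · intro i _
      linarith [Real.add_one_le_exp (hP.1.eigenvalues i - 1)]
  rw [← h1, ← Real.exp_sum, Finset.sum_sub_distrib, ← h2] at h3
  have h4 : Real.exp (M.trace.re + ‖M‖ ^ 2 / 2) ^ 2
      = Real.exp (Fintype.card m + 2 * M.trace.re + ‖M‖ ^ 2 - ∑ _i : m, (1 : ℝ)) := by
    rw [← Real.exp_nat_mul]
    congr 1
    simp
    ring
  rw [← h4] at h3
  exact le_of_sq_le_sq h3 (Real.exp_pos _).le

/-- The regularized determinant `det (1 + M) exp (-Tr M)`. -/
noncomputable def Matrix.regDet (M : Matrix m m ℂ) : ℂ := (1 + M).det * Complex.exp (-M.trace)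

theorem Matrix.norm_regDet_le (M : Matrix m m ℂ) : ‖M.regDet‖ ≤ Real.exp (‖M‖ ^ 2 / 2) := by
  rw [Matrix.regDet, norm_mul, Complex.norm_exp, Complex.neg_re]
  calc _ ≤ Real.exp (M.trace.re + ‖M‖ ^ 2 / 2) * Real.exp (-M.trace.re) := by
        gcongr
        exact M.norm_det_one_add_le
    _ = _ := by rw [← Real.exp_add]; congr 1; ring

theorem Matrix.differentiable_regDet_line (A B : Matrix m m ℂ) :
    Differentiable ℂ fun z : ℂ => (B + z • A).regDet := by
  unfold Matrix.regDet
  simp only [Matrix.det_apply, Matrix.trace, Matrix.add_apply, Matrix.smul_apply, Matrix.diag]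
  fun_prop

/-- A Schwarz lemma argument replaces any differentiation of determinants. On the disc of radius
`δ⁻¹` the entire function `z ↦ regDet (B + z (A - B))` is bounded by a constant free of the matrix
size, and `z = 0, 1` give `B` and `A`. -/
theorem Matrix.norm_regDet_sub_le {A B : Matrix m m ℂ} {K δ : ℝ} (hB : ‖B‖ ≤ K) (hδ0 : 0 < δ)
    (hδ : δ < 1) (hAB : ‖A - B‖ ≤ δ) :
    ‖A.regDet - B.regDet‖ ≤ δ * (2 * Real.exp ((K + 1) ^ 2 / 2)) := by
  set C := Real.exp ((K + 1) ^ 2 / 2)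
  have hbound : ∀ z ∈ Metric.ball (0 : ℂ) δ⁻¹, ‖(B + z • (A - B)).regDet‖ ≤ C := by
    intro z hz
    refine (Matrix.norm_regDet_le _).trans (Real.exp_le_exp.2 ?_)
    have hz' : ‖z‖ ≤ δ⁻¹ := by simpa using (Metric.mem_ball.1 hz).le
    have h1 : ‖B + z • (A - B)‖ ≤ K + 1 := by
      refine (norm_add_le _ _).trans (add_le_add hB ?_)
      rw [norm_smul]
      calc ‖z‖ * ‖A - B‖ ≤ δ⁻¹ * δ := by gcongr
        _ = 1 := inv_mul_cancel₀ hδ0.ne'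
    gcongr
  have hmaps : Set.MapsTo (fun z : ℂ => (B + z • (A - B)).regDet) (Metric.ball 0 δ⁻¹)
      (Metric.closedBall ((B + (0 : ℂ) • (A - B)).regDet) (2 * C)) := by
    intro z hz
    rw [Metric.mem_closedBall, dist_eq_norm]
    refine (norm_sub_le _ _).trans ?_
    have h0 := hbound 0 (by simpa using hδ0)
    linarith [hbound z hz]
  have h1 : (1 : ℂ) ∈ Metric.ball (0 : ℂ) δ⁻¹ := by
    simpa using (one_lt_inv₀ hδ0).2 hδ
  have := Complex.dist_le_div_mul_dist_of_mapsTo_ball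
    (Matrix.differentiable_regDet_line (A - B) B).differentiableOn hmaps h1
  simp only [one_smul, zero_smul, add_zero, add_sub_cancel] at this
  rw [dist_eq_norm] at this
  refine this.trans_eq ?_
  simp
  ring

end FiniteDet

/-! ## Hilbert-Schmidt operators in a Hilbert basis -/

section HilbertBasis

variable {H : Type*} [NormedAddCommGroup H] [InnerProductSpace ℂ H] {ι : Type*}

theorem HilbertBasis.hasSum_norm_inner_sq (b : HilbertBasis ι ℂ H) (x : H) :
    HasSum (fun i => ‖inner ℂ (b i) x‖ ^ 2) (‖x‖ ^ 2) := by
  have h := Complex.hasSum_re (b.hasSum_inner_mul_inner x x)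
  rw [inner_self_eq_norm_sq_to_K] at h
  convert h using 1
  · ext i
    have h1 := inner_mul_symm_re_eq_norm (𝕜 := ℂ) x (b i)
    rw [norm_mul, norm_inner_symm x (b i), ← sq] at h1
    exact h1.symm
  · norm_cast

/-- `IsHilbertSchmidt` asks for a basis indexed by a set of vectors, so `b` is reindexed by its own
range. -/
theorem HilbertBasis.isHilbertSchmidt [CompleteSpace H] (b : HilbertBasis ι ℂ H) {F : H →L[ℂ] H}
    (h : Summable fun i => ‖F (b i)‖ ^ 2) : IsHilbertSchmidt F := by
  have hinj : Function.Injective b := b.orthonormal.linearIndependent.injective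
  let e := Equiv.ofInjective b hinj
  have hsp : ⊤ ≤ (Submodule.span ℂ (Set.range ((↑) : Set.range b → H))).topologicalClosure := by
    rw [Subtype.range_coe, b.dense_span]
  refine ⟨Set.range b, HilbertBasis.mk b.orthonormal.toSubtypeRange hsp, ?_⟩
  rw [← e.summable_iff]
  simpa [Function.comp_def, e] using h

theorem HilbertBasis.summable_norm_inner_sq (b : HilbertBasis ι ℂ H) {F : H →L[ℂ] H}
    (h : Summable fun i => ‖F (b i)‖ ^ 2) :
    Summable fun p : ι × ι => ‖inner ℂ (b p.1) (F (b p.2))‖ ^ 2 := by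
  have : Summable fun p : ι × ι => ‖inner ℂ (b p.2) (F (b p.1))‖ ^ 2 := by
    rw [summable_prod_of_nonneg (fun p => by positivity)]
    refine ⟨fun i => (b.hasSum_norm_inner_sq (F (b i))).summable, ?_⟩
    simpa only [(b.hasSum_norm_inner_sq (F (b _))).tsum_eq] using h
  exact (Equiv.prodComm ι ι).summable_iff.1 this

/-- The square summable matrix of `F` is summed along its other index. -/
theorem HilbertBasis.summable_adjoint [CompleteSpace H] (b : HilbertBasis ι ℂ H) {F : H →L[ℂ] H}
    (h : Summable fun i => ‖F (b i)‖ ^ 2) :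
    Summable fun i => ‖F.adjoint (b i)‖ ^ 2 := by
  have h1 := b.summable_norm_inner_sq h
  rw [summable_prod_of_nonneg (fun p => by positivity)] at h1
  refine h1.2.congr fun i => ?_
  rw [← (b.hasSum_norm_inner_sq (F.adjoint (b i))).tsum_eq]
  congr 1 with j
  rw [ContinuousLinearMap.adjoint_inner_right, norm_inner_symm]

/-! ## Compressions to the span of finitely many basis vectors -/

/-- The finite section of an infinite matrix. -/
def finSection (f : ι → ι → ℂ) (s : Finset ι) : Matrix s s ℂ := Matrix.of fun i j => f i j

theorem trace_finSection (f : ι → ι → ℂ) (s : Finset ι) :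
    (finSection f s).trace = ∑ i ∈ s, f i i := by
  rw [Matrix.trace, ← Finset.sum_coe_sort s fun i => f i i]
  rfl

/-- `compression` acts on the range of the projection, which equals `K` only propositionally; the
basis is built on the range itself. -/
theorem HilbertBasis.exists_orthonormalBasis_range (b : HilbertBasis ι ℂ H) (s : Finset ι)
    {K : Submodule ℂ H} [K.HasOrthogonalProjection] (hK : K = Submodule.span ℂ (b '' s)) :
    ∃ v : OrthonormalBasis s ℂ (K.starProjection : H →ₗ[ℂ] H).range, ∀ i, (v i : H) = b i := by
  have hmem (i : s) : b i ∈ K := hK ▸ Submodule.subset_span ⟨i, i.2, rfl⟩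
  have hrange : (K.starProjection : H →ₗ[ℂ] H).range = K := Submodule.range_starProjection K
  let w : s → (K.starProjection : H →ₗ[ℂ] H).range := fun i => ⟨b i, hrange.ge (hmem i)⟩
  have hw : Orthonormal ℂ w := by
    classical
    have h1 : Orthonormal ℂ fun i : s => b i := b.orthonormal.comp _ Subtype.val_injective
    rw [orthonormal_iff_ite] at h1 ⊢
    exact h1
  have hsp : ⊤ ≤ Submodule.span ℂ (Set.range w) := by
    have hinj := Submodule.map_injective_of_injective
      (K.starProjection : H →ₗ[ℂ] H).range.injective_subtype
    rw [top_le_iff]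
    apply hinj
    rw [Submodule.map_span, Submodule.map_top, Submodule.range_subtype, ← Set.range_comp]
    refine Eq.trans ?_ (hK.symm.trans hrange.symm)
    congr 1
    ext x
    simp [w]
  exact ⟨OrthonormalBasis.mk hw hsp, fun i => by simp [w]⟩

variable {K : Submodule ℂ H} [K.HasOrthogonalProjection]

theorem inner_compression_starProjection (F : H →L[ℂ] H)
    (x y : (K.starProjection : H →ₗ[ℂ] H).range) :
    inner ℂ x (compression K.starProjection F y) = inner ℂ (x : H) (F y) := by
  have hfix (z : (K.starProjection : H →ₗ[ℂ] H).range) : K.starProjection (z : H) = z := by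
    rw [Submodule.starProjection_eq_self_iff]
    exact (Submodule.range_starProjection K).le z.2
  change inner ℂ (x : H) (K.starProjection (F (K.starProjection y))) = _
  rw [hfix, ← Submodule.inner_starProjection_left_eq_right, hfix]

theorem HilbertBasis.compressedTrace_starProjection (b : HilbertBasis ι ℂ H) (s : Finset ι)
    (hK : K = Submodule.span ℂ (b '' s)) (F : H →L[ℂ] H) :
    compressedTrace K.starProjection F = ∑ i ∈ s, inner ℂ (b i) (F (b i)) := by
  obtain ⟨v, hv⟩ := b.exists_orthonormalBasis_range s hK
  rw [compressedTrace, LinearMap.trace_eq_sum_inner _ v,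
    ← Finset.sum_coe_sort s fun i => inner ℂ (b i) (F (b i))]
  simp only [inner_compression_starProjection, hv]

theorem HilbertBasis.compressedDet_starProjection [DecidableEq ι] (b : HilbertBasis ι ℂ H)
    (s : Finset ι) (hK : K = Submodule.span ℂ (b '' s)) (F : H →L[ℂ] H) :
    compressedDet K.starProjection F = 
      (1 + finSection (fun i j => inner ℂ (b i) (F (b j))) s).det := by
  obtain ⟨v, hv⟩ := b.exists_orthonormalBasis_range s hK
  rw [compressedDet, ← LinearMap.det_toMatrix v.toBasis, map_add, LinearMap.toMatrix_id]
  congr 2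
  ext i j
  rw [LinearMap.toMatrix_apply, v.coe_toBasis, v.coe_toBasis_repr_apply, v.repr_apply_apply,
    inner_compression_starProjection, hv, hv]
  rfl

end HilbertBasis

/-! ### Comparing finite sections of different sizes -/

section ExtendMatrix

variable {ι : Type*} [DecidableEq ι]

/-- The inclusion of the coordinates in `s` into those in `t`. -/
def inclMatrix (s t : Finset ι) : Matrix t s ℂ := Matrix.of fun i j => if (i : ι) = j then 1 else 0

theorem inclMatrix_transpose_mul_self {s t : Finset ι} (hst : s ⊆ t) :
    (inclMatrix s t).transpose * inclMatrix s t = 1 := by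
  ext i j
  rw [Matrix.mul_apply, Finset.sum_eq_single ⟨i, hst i.2⟩]
  · rw [Matrix.transpose_apply, Matrix.one_apply]
    simp only [inclMatrix, Matrix.of_apply, if_true, one_mul, Subtype.ext_iff]
  · rintro k - hk
    have : (k : ι) ≠ i := fun h => hk (Subtype.ext h)
    simp [inclMatrix, this]
  · simp

/-- Padding by zeros changes neither factor, by `det (1 + X Y) = det (1 + Y X)` and the cyclicity of
the trace. Sections of different sizes can thus be compared inside one matrix algebra. -/
theorem regDet_incl {s t : Finset ι} (hst : s ⊆ t) (M : Matrix s s ℂ) :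
    (inclMatrix s t * M * (inclMatrix s t).transpose).regDet = M.regDet := by
  rw [Matrix.regDet, Matrix.regDet, Matrix.mul_assoc, Matrix.det_one_add_mul_comm,
    Matrix.mul_assoc, inclMatrix_transpose_mul_self hst, Matrix.mul_one, Matrix.trace_mul_comm,
    Matrix.mul_assoc, inclMatrix_transpose_mul_self hst, Matrix.mul_one]

theorem incl_finSection (s t : Finset ι) (f : ι → ι → ℂ) :
    inclMatrix s t * finSection f s * (inclMatrix s t).transpose =
      finSection (fun i j => if i ∈ s ∧ j ∈ s then f i j else 0) t := by
  ext i j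
  have h1 (k : s) : (inclMatrix s t * finSection f s) i k =
      if (i : ι) ∈ s then f i k else 0 := by
    rw [Matrix.mul_apply]
    by_cases hi : (i : ι) ∈ s
    · rw [Finset.sum_eq_single ⟨i, hi⟩]
      · simp [inclMatrix, finSection, hi]
      · rintro l - hl
        have : (i : ι) ≠ l := fun h => hl (Subtype.ext h.symm)
        simp [inclMatrix, this]
      · simp
    · rw [if_neg hi]
      refine Finset.sum_eq_zero fun l _ => ?_
      have : (i : ι) ≠ l := fun h => hi (h ▸ l.2)
      simp [inclMatrix, this]
  rw [Matrix.mul_apply]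
  simp only [h1]
  rw [finSection, Matrix.of_apply]
  by_cases hj : (j : ι) ∈ s
  · rw [Finset.sum_eq_single ⟨j, hj⟩]
    · by_cases hi : (i : ι) ∈ s <;> simp [inclMatrix, hj, hi]
    · rintro l - hl
      have : (j : ι) ≠ l := fun h => hl (Subtype.ext h.symm)
      simp [inclMatrix, this]
    · simp
  · rw [if_neg (fun h => hj h.2)]
    refine Finset.sum_eq_zero fun l _ => ?_
    have : (j : ι) ≠ l := fun h => hj (h ▸ l.2)
    simp [inclMatrix, this]

open scoped Matrix.Norms.Frobenius

/-- The regularized determinants of the finite sections of a square summable matrix converge. -/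
theorem cauchySeq_regDet {f : ι → ι → ℂ} (hf : Summable fun p : ι × ι => ‖f p.1 p.2‖ ^ 2)
    {s : ℕ → Finset ι} (hs : Monotone s) (hs' : ∀ i, ∃ N, i ∈ s N) :
    CauchySeq fun N => (finSection f (s N)).regDet := by
  set C := Real.sqrt (∑' p : ι × ι, ‖f p.1 p.2‖ ^ 2)
  set L := 2 * Real.exp ((C + 1) ^ 2 / 2)
  have hL : 0 < L := by positivity
  have hsum (t : Finset ι) (g : ι → ι → ℂ) :
      ‖finSection g t‖ ^ 2 = ∑ p ∈ t ×ˢ t, ‖g p.1 p.2‖ ^ 2 := by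
    rw [Matrix.frobenius_norm_sq, Finset.sum_product,
      ← Finset.sum_coe_sort t fun i => ∑ j ∈ t, ‖g i j‖ ^ 2]
    refine Finset.sum_congr rfl fun i _ => ?_
    rw [← Finset.sum_coe_sort t fun j => ‖g i j‖ ^ 2]
    rfl
  rw [Metric.cauchySeq_iff']
  intro ε hε
  -- The bound `1 / 2` puts the point `1` inside the disc of radius `δ⁻¹`; the other bound makes the
  -- final estimate `ε / 2`.
  set δ := min (1 / 2) (ε / (2 * L))
  have hδ0 : 0 < δ := by positivity
  have hδ1 : δ < 1 := (min_le_left _ _).trans_lt (by norm_num)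
  have hδL : δ * L < ε := by
    calc δ * L ≤ ε / (2 * L) * L := by gcongr; exact min_le_right _ _
      _ = ε / 2 := by field_simp
      _ < ε := by linarith
  obtain ⟨u, hu⟩ := summable_iff_vanishing_norm.1 hf (δ ^ 2) (by positivity)
  have hN : ∃ N, u ⊆ s N ×ˢ s N := by
    have h1 : Tendsto (fun N => s N ×ˢ s N) atTop atTop := by
      refine tendsto_atTop_finset_of_monotone ?_ ?_
      · intro a b hab
        exact Finset.product_subset_product (hs hab) (hs hab)
      · rintro ⟨i, j⟩
        obtain ⟨a, ha⟩ := hs' i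
        obtain ⟨c, hc⟩ := hs' j
        exact ⟨max a c, Finset.mk_mem_product (hs (le_max_left a c) ha) (hs (le_max_right a c) hc)⟩
    exact (h1.eventually_ge_atTop u).exists
  obtain ⟨N, hN⟩ := hN
  refine ⟨N, fun k hk => ?_⟩
  have hNk := hs hk
  -- After padding the smaller section, the difference is supported off the square `s N ×ˢ s N ⊇ u`,
  -- where the tail of the square sum is below `δ ^ 2`.
  rw [dist_eq_norm, ← regDet_incl hNk, incl_finSection]
  refine (Matrix.norm_regDet_sub_le (K := C) ?_ hδ0 hδ1 ?_).trans_lt hδL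
  · apply Real.le_sqrt_of_sq_le
    rw [hsum]
    refine (Finset.sum_le_sum fun p _ => ?_).trans
      (hf.sum_le_tsum (s k ×ˢ s k) fun p _ => by positivity)
    split_ifs <;> simp
  · apply le_of_sq_le_sq _ hδ0.le
    have : finSection f (s k) -
        finSection (fun a c => if a ∈ s N ∧ c ∈ s N then f a c else 0) (s k) =
        finSection (fun a c => if a ∈ s N ∧ c ∈ s N then 0 else f a c) (s k) := by
      ext i j
      simp only [finSection, Matrix.sub_apply, Matrix.of_apply]
      split_ifs <;> simp
    rw [this, hsum]
    have h2 : ∑ p ∈ s k ×ˢ s k, ‖if p.1 ∈ s N ∧ p.2 ∈ s N then 0 else f p.1 p.2‖ ^ 2 =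
        ∑ p ∈ (s k ×ˢ s k) \ (s N ×ˢ s N), ‖f p.1 p.2‖ ^ 2 := by
      rw [Finset.sdiff_eq_filter, Finset.sum_filter]
      refine Finset.sum_congr rfl fun p _ => ?_
      simp only [Finset.mem_product]
      split_ifs <;> simp_all
    rw [h2]
    have h3 := hu ((s k ×ˢ s k) \ (s N ×ˢ s N)) (Finset.sdiff_disjoint.mono_right hN)
    exact (le_abs_self _).trans h3.le

end ExtendMatrix

/-! ### From regularized to conditional determinants -/

section ConditionalDet

variable {H : Type*} [NormedAddCommGroup H] [InnerProductSpace ℂ H] {ι : Type*}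

/-- The conditional determinant exists for a Hilbert-Schmidt operator with a conditional trace. -/
theorem HilbertBasis.exists_hasConditionalDet (b : HilbertBasis ι ℂ H) {s : ℕ → Finset ι}
    (hs : Monotone s) (hs' : ∀ i, ∃ N, i ∈ s N) (K : ℕ → Submodule ℂ H)
    [∀ N, (K N).HasOrthogonalProjection] (hK : ∀ N, K N = Submodule.span ℂ (b '' s N))
    {F : H →L[ℂ] H} (hF : Summable fun i => ‖F (b i)‖ ^ 2) {c : ℂ}
    (hc : HasConditionalTrace (fun N => (K N).starProjection) F c) :
    ∃ d, HasConditionalDet (fun N => (K N).starProjection) F d := by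
  classical
  obtain ⟨r, hr⟩ := cauchySeq_tendsto_of_complete
    (cauchySeq_regDet (f := fun i j => inner ℂ (b i) (F (b j))) (b.summable_norm_inner_sq hF) hs hs')
  have hc' : Tendsto (fun N => compressedTrace (K N).starProjection F) atTop (𝓝 c) := hc
  have h2 := hr.mul (hc'.cexp)
  refine ⟨r * Complex.exp c, h2.congr fun N => ?_⟩
  rw [b.compressedTrace_starProjection (s N) (hK N), b.compressedDet_starProjection (s N) (hK N),
    Matrix.regDet, mul_assoc, ← Complex.exp_add, trace_finSection, neg_add_cancel,
    Complex.exp_zero, mul_one]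

end ConditionalDet

/-! ## Fourier series on an interval -/

section Fourier

open scoped ComplexConjugate

/-- Parseval for two functions, transported from the circle of length `b - a`; the factor `(b -
a)⁻¹` comes from the normalized Haar measure. -/
theorem hasSum_conj_fourierCoeffOn_mul {a b : ℝ} {f g : ℝ → ℂ} (hab : a < b)
    (hf : MemLp f 2 (volume.restrict (Set.Ioc a b)))
    (hg : MemLp g 2 (volume.restrict (Set.Ioc a b))) :
    HasSum (fun i => conj (fourierCoeffOn hab f i) * fourierCoeffOn hab g i)
      ((b - a)⁻¹ • ∫ x in a..b, conj (f x) * g x) := by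
  have := Fact.mk (by linarith : 0 < b - a)
  rw [← add_sub_cancel a b] at hf hg
  have h := hf.memLp_liftIoc.haarAddCircle
  have k := hg.memLp_liftIoc.haarAddCircle
  have key := (fourierBasis (T := b - a)).hasSum_inner_mul_inner h.toLp k.toLp
  convert! key using 1
  · ext i
    rw [← fourierBasis.repr_apply_apply, ← inner_conj_symm, ← fourierBasis.repr_apply_apply,
      fourierBasis_repr, fourierBasis_repr]
    simp [fourierCoeff_congr_ae h.coeFn_toLp, fourierCoeff_congr_ae k.coeFn_toLp,
      fourierCoeff_liftIoc_eq]
  · rw [MeasureTheory.L2.inner_def]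
    have h1 : ∫ x in a..b, conj (f x) * g x =
        ∫ x in a..a + (b - a), conj (f x) * g x := by rw [add_sub_cancel]
    rw [h1, ← AddCircle.integral_liftIoc_eq_intervalIntegral, ← AddCircle.integral_haarAddCircle]
    apply integral_congr_ae
    filter_upwards [h.coeFn_toLp, k.coeFn_toLp] with x hx kx
    rw [hx, kx, RCLike.inner_apply']
    rfl

theorem ae_eq_zero_of_fourierCoeffOn_eq_zero {a b : ℝ} {f : ℝ → ℂ} (hab : a < b)
    (hf : MemLp f 2 (volume.restrict (Set.Ioc a b))) (h0 : ∀ i, fourierCoeffOn hab f i = 0) :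
    f =ᵐ[volume.restrict (Set.Ioc a b)] 0 := by
  have h1 : HasSum (fun i => ‖fourierCoeffOn hab f i‖ ^ 2) 0 := by
    simp only [h0, norm_zero, ne_eq, OfNat.ofNat_ne_zero, not_false_eq_true, zero_pow]
    exact hasSum_zero
  have h := (hasSum_sq_fourierCoeffOn hab hf).unique h1
  have hba : (b - a)⁻¹ ≠ 0 := inv_ne_zero (by linarith)
  rw [smul_eq_zero, or_iff_right hba, intervalIntegral.integral_of_le hab.le,
    integral_eq_zero_iff_of_nonneg (fun x => by positivity)
      ((memLp_two_iff_integrable_sq_norm hf.1).1 hf)] at h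
  filter_upwards [h] with x hx
  simpa using hx

theorem fourierCoeffOn_neg_eq {a b : ℝ} (hab : a < b) (f : ℝ → ℂ) (k : ℤ) :
    fourierCoeffOn hab f (-k) = ((b - a)⁻¹ : ℝ) *
      ∫ x in a..b, Complex.exp (2 * Real.pi * Complex.I * k * x / (b - a)) * f x := by
  rw [fourierCoeffOn_eq_integral, neg_neg, Complex.real_smul, one_div]
  simp only [fourier_coe_apply, smul_eq_mul, Complex.ofReal_sub]

/-- Completeness of the vectors `(cos (λ_k t), sin (λ_k t))`, `λ_k = (θ + k π) / T`, in
`L²([0, T]; ℂ²)`. -/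
theorem ae_eq_zero_of_forall_integral_cos_add_sin {T : ℝ} (hT : 0 < T) (θ : ℝ) {a b : ℝ → ℂ}
    (ha : MemLp a 2 (vol T)) (hb : MemLp b 2 (vol T))
    (h : ∀ k : ℤ, ∫ t, (Complex.cos ((θ + k * Real.pi) / T * t) * a t +
      Complex.sin ((θ + k * Real.pi) / T * t) * b t) ∂(vol T) = 0) :
    a =ᵐ[vol T] 0 ∧ b =ᵐ[vol T] 0 := by
  have hvol : vol T = volume.restrict (Set.Ioo 0 T) :=
    Measure.restrict_congr_set Ioo_ae_eq_Icc.symm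
  rw [hvol] at ha hb h ⊢
  -- Twice `cos (λ t) a + sin (λ t) b` is `exp (i λ t) (a - i b) + exp (-i λ t) (a + i b)`.
  -- Reflecting the second term turns the hypotheses into integrals of `exp (i λ t) (u t + v (-t))`
  -- over `(-T, T)`. The open interval keeps the supports of `u` and `v (-·)` disjoint.
  set u : ℝ → ℂ := (Set.Ioo 0 T).indicator fun t => a t - Complex.I * b t
  set v : ℝ → ℂ := (Set.Ioo 0 T).indicator fun t => a t + Complex.I * b t
  have hu : MemLp u 2 volume :=
    (memLp_indicator_iff_restrict measurableSet_Ioo).2 (ha.sub (hb.const_mul Complex.I))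
  have hv : MemLp v 2 volume :=
    (memLp_indicator_iff_restrict measurableSet_Ioo).2 (ha.add (hb.const_mul Complex.I))
  have hv' : MemLp (fun t => v (-t)) 2 volume :=
    hv.comp_measurePreserving (Measure.measurePreserving_neg volume)
  have hu1 : Integrable u volume := by
    rw [integrable_indicator_iff measurableSet_Ioo]
    exact (ha.sub (hb.const_mul Complex.I)).integrable (by norm_num)
  have hv1 : Integrable v volume := by
    rw [integrable_indicator_iff measurableSet_Ioo]
    exact (ha.add (hb.const_mul Complex.I)).integrable (by norm_num)
  have hE (c : ℂ) (hc : c.re = 0) : ∀ t : ℝ, ‖Complex.exp (c * t)‖ = 1 := by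
    intro t
    rw [Complex.norm_exp]
    simp [hc]
  have hEm (c : ℂ) : Continuous fun t : ℝ => Complex.exp (c * t) := by fun_prop
  have hET : ∀ x : ℝ, (Complex.I * x).re = 0 := by simp
  -- The twist by `exp (i θ t / T)` absorbs the shift in `λ_k`; what remains has frequencies `k π /
  -- T`, the Fourier modes of period `2 T`.
  set c : ℂ := Complex.I * ((θ / T : ℝ) : ℂ)
  have hsum : MemLp (fun t : ℝ => Complex.exp (c * t) * (u t + v (-t))) 2 volume :=
    (hu.add hv').of_le ((hEm c).aestronglyMeasurable.mul (hu.add hv').1)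
      (Eventually.of_forall fun t => by
        simp only [norm_mul, hE c (hET _), one_mul]; rfl)
  have hTT : -T < T := by linarith
  have hcoef : ∀ k : ℤ, fourierCoeffOn hTT (fun t : ℝ => Complex.exp (c * t) * (u t + v (-t))) k = 0 := by
    intro k
    obtain ⟨k, rfl⟩ : ∃ l, k = -l := ⟨-k, by simp⟩
    rw [fourierCoeffOn_neg_eq]
    set d : ℂ := Complex.I * (((θ + k * Real.pi) / T : ℝ) : ℂ) with hd
    have hint (w : ℝ → ℂ) (hw : Integrable w volume) (e : ℂ) (he : e.re = 0) :
        Integrable (fun t : ℝ => Complex.exp (e * t) * w t) volume :=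
      hw.bdd_mul (hEm e).aestronglyMeasurable
        (Eventually.of_forall fun t => (hE e he t).le)
    have h1 : ∫ x in (-T)..T, Complex.exp (2 * Real.pi * Complex.I * k * x / (T - (-T : ℝ))) *
        (Complex.exp (c * x) * (u x + v (-x))) = ∫ x : ℝ, Complex.exp (d * x) * (u x + v (-x)) := by
      rw [intervalIntegral.integral_of_le hTT.le, ← integral_indicator measurableSet_Ioc]
      congr 1 with x
      by_cases hx : x ∈ Set.Ioc (-T) T
      · rw [Set.indicator_of_mem hx, ← mul_assoc, ← Complex.exp_add]
        congr 2
        have : (T : ℂ) ≠ 0 := by exact_mod_cast hT.ne'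
        simp only [hd, c]
        push_cast
        field_simp
        ring
      · rw [Set.indicator_of_notMem hx, eq_comm, mul_eq_zero]
        right
        have h1 : x ∉ Set.Ioo 0 T := fun h => hx ⟨by linarith [h.1], h.2.le⟩
        have h2 : -x ∉ Set.Ioo 0 T := fun h => hx ⟨by linarith [h.2], by linarith [h.1]⟩
        simp only [u, v, Set.indicator_of_notMem h1, Set.indicator_of_notMem h2, add_zero]
    rw [h1]
    simp only [mul_add]
    have hdre : d.re = 0 := hET _
    have hdre' : (-d).re = 0 := by rw [Complex.neg_re, hdre, neg_zero]
    have h2 : ∫ x : ℝ, Complex.exp (d * x) * v (-x) = ∫ x : ℝ, Complex.exp (-d * x) * v x := by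
      rw [← integral_neg_eq_self]
      simp
    have h3 : Integrable (fun x : ℝ => Complex.exp (d * x) * v (-x)) volume :=
      hint (fun x => v (-x)) hv1.comp_neg d hdre
    rw [integral_add (hint u hu1 d hdre) h3, h2, ← integral_add (hint u hu1 d hdre)
      (hint v hv1 (-d) hdre')]
    have h4 : (fun x : ℝ => Complex.exp (d * x) * u x + Complex.exp (-d * x) * v x) =
        (Set.Ioo 0 T).indicator fun t : ℝ => 2 * (Complex.cos ((θ + k * Real.pi) / T * t) * a t +
          Complex.sin ((θ + k * Real.pi) / T * t) * b t) := by
      ext x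
      by_cases hx : x ∈ Set.Ioo 0 T
      · simp only [u, v, Set.indicator_of_mem hx, Complex.cos, Complex.sin]
        have e1 : (θ + k * Real.pi) / T * x * Complex.I = d * x := by
          simp only [hd]; push_cast; ring
        have e2 : -((θ + k * Real.pi) / T * x : ℂ) * Complex.I = -d * x := by
          simp only [hd]; push_cast; ring
        rw [e1, e2]
        ring
      · simp only [u, v, Set.indicator_of_notMem hx, mul_zero, add_zero]
    rw [h4, integral_indicator measurableSet_Ioo, integral_const_mul, h k, mul_zero, mul_zero]
  have hzero := ae_eq_zero_of_fourierCoeffOn_eq_zero hTT (hsum.mono_measure Measure.restrict_le_self)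
    hcoef
  rw [EventuallyEq, ae_restrict_iff' measurableSet_Ioc] at hzero
  have hzero' : ∀ᵐ t : ℝ, t ∈ Set.Ioc (-T) T → u t + v (-t) = 0 := by
    filter_upwards [hzero] with t ht hmem
    simpa using ht hmem
  have hzero'' : ∀ᵐ t : ℝ, -t ∈ Set.Ioc (-T) T → u (-t) + v t = 0 := by
    have := (Measure.measurePreserving_neg (volume : Measure ℝ)).quasiMeasurePreserving.ae hzero'
    simpa using this
  have key : ∀ᵐ t ∂(volume.restrict (Set.Ioo 0 T)), a t = 0 ∧ b t = 0 := by
    rw [ae_restrict_iff' measurableSet_Ioo]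
    filter_upwards [hzero', hzero''] with t h1 h2 ht
    have hn : -t ∉ Set.Ioo 0 T := fun h => by linarith [h.1, ht.1]
    have k1 := h1 ⟨by linarith [ht.1], ht.2.le⟩
    have k2 := h2 ⟨by linarith [ht.2], by linarith [ht.1]⟩
    simp only [u, v, Set.indicator_of_mem ht, Set.indicator_of_notMem hn, add_zero, zero_add]
      at k1 k2
    have ha0 : a t = 0 := by linear_combination (k1 + k2) / 2
    refine ⟨ha0, ?_⟩
    rw [ha0, zero_add] at k2
    simpa using k2
  exact ⟨key.mono fun t h => h.1, key.mono fun t h => h.2⟩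

/-- The numbers `1 / (k + α)` are, up to the factor `w / (2 π i)` with `w = 1 - exp (-2 π i α)`,
conjugated Fourier coefficients of `p`. Parseval pairs them with those of `q`, and the exponentials
in `conj p * q` cancel to leave `f`. The constant is `2 π i / w = π (cot (π α) + i)`. The
convergence is unconditional, unlike that of the sum of `1 / (k + α)` alone. -/
theorem hasSum_inv_mul_integral_exp {T : ℝ} (hT : 0 < T) {α : ℂ} (hα : ∀ k : ℤ, (k : ℂ) + α ≠ 0)
    {f : ℝ → ℂ} (hf : ContinuousOn f (Set.Icc 0 T)) :
    HasSum (fun k : ℤ => (k + α)⁻¹ *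
        ∫ t in 0..T, f t * Complex.exp (2 * Real.pi * Complex.I * (k + α) * t / T))
      (Real.pi * (Complex.cot (Real.pi * α) + Complex.I) * ∫ t in 0..T, f t) := by
  have hTc : (T : ℂ) ≠ 0 := by exact_mod_cast hT.ne'
  have hpi : (Real.pi : ℂ) ≠ 0 := by exact_mod_cast Real.pi_ne_zero
  have hmem {g : ℝ → ℂ} (hg : ContinuousOn g (Set.Icc 0 T)) :
      MemLp g 2 (volume.restrict (Set.Ioc 0 T)) := by
    obtain ⟨C, hC⟩ := isCompact_Icc.exists_bound_of_continuousOn hg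
    have h1 : MemLp g 2 (volume.restrict (Set.Icc 0 T)) :=
      MemLp.of_bound (hg.aestronglyMeasurable measurableSet_Icc) C
        ((ae_restrict_iff' measurableSet_Icc).2 (Eventually.of_forall hC))
    exact h1.mono_measure (Measure.restrict_mono Set.Ioc_subset_Icc_self le_rfl)
  set p : ℝ → ℂ := fun t => conj (Complex.exp (-(2 * Real.pi * Complex.I * α * t / T))) with hp
  set q : ℝ → ℂ := fun t => f t * Complex.exp (2 * Real.pi * Complex.I * α * t / T) with hq
  have hpm : MemLp p 2 (volume.restrict (Set.Ioc 0 T)) := hmem (by fun_prop)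
  have hqm : MemLp q 2 (volume.restrict (Set.Ioc 0 T)) := hmem (by fun_prop)
  -- The reindexing `k ↦ -k` gives the exponentials in the coefficients a positive sign.
  have h1 := (Equiv.neg ℤ).hasSum_iff.2 (hasSum_conj_fourierCoeffOn_mul hT hpm hqm)
  set w : ℂ := 1 - Complex.exp (-(2 * Real.pi * Complex.I * α)) with hw
  have hw0 : w ≠ 0 := by
    intro h
    rw [hw, sub_eq_zero, eq_comm, Complex.exp_eq_one_iff] at h
    obtain ⟨k, hk⟩ := h
    apply hα k
    have : (2 * Real.pi * Complex.I : ℂ) ≠ 0 := Complex.two_pi_I_ne_zero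
    apply mul_left_cancel₀ this
    linear_combination -hk
  have hpc (k : ℤ) : conj (fourierCoeffOn hT p (-k)) =
      w / (2 * Real.pi * Complex.I * (k + α)) := by
    have hne : -(2 * Real.pi * Complex.I * (k + α) / T) ≠ 0 :=
      neg_ne_zero.2 (div_ne_zero (mul_ne_zero Complex.two_pi_I_ne_zero (hα k)) hTc)
    rw [fourierCoeffOn_neg_eq, map_mul, Complex.conj_ofReal,
      intervalIntegral.integral_of_le hT.le, ← integral_conj,
      ← intervalIntegral.integral_of_le hT.le]
    have : ∀ x : ℝ, conj (Complex.exp (2 * Real.pi * Complex.I * k * x / (T - (0 : ℝ))) * p x) =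
        Complex.exp (-(2 * Real.pi * Complex.I * (k + α) / T) * x) := by
      intro x
      rw [map_mul, hp, Complex.conj_conj, ← Complex.exp_conj, ← Complex.exp_add]
      congr 1
      simp only [map_mul, map_div₀, Complex.conj_I, Complex.conj_ofReal, map_ofNat,
        map_intCast, Complex.ofReal_zero, sub_zero]
      field_simp
      ring
    simp only [this]
    rw [integral_exp_mul_complex hne]
    have h2 : -(2 * Real.pi * Complex.I * (k + α) / T) * (T : ℂ) =
        -(2 * Real.pi * Complex.I * α) + (-k : ℤ) * (2 * Real.pi * Complex.I) := by
      field_simp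
      push_cast
      ring
    rw [h2, Complex.exp_add, Complex.exp_int_mul_two_pi_mul_I, hw]
    have h3 := hα k
    have h4 := Complex.I_ne_zero
    simp
    field_simp
    ring
  have hqc (k : ℤ) : fourierCoeffOn hT q (-k) = (T : ℂ)⁻¹ *
      ∫ t in 0..T, f t * Complex.exp (2 * Real.pi * Complex.I * (k + α) * t / T) := by
    rw [fourierCoeffOn_neg_eq]
    simp only [sub_zero, Complex.ofReal_inv, Complex.ofReal_zero]
    congr 2 with x
    rw [hq, mul_left_comm, ← Complex.exp_add]
    congr 2
    ring
  have hpq : ∫ x in 0..T, conj (p x) * q x = ∫ t in 0..T, f t := by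
    congr 1 with x
    rw [hp, hq, Complex.conj_conj, mul_left_comm, ← Complex.exp_add, neg_add_cancel,
      Complex.exp_zero, mul_one]
  rw [hpq] at h1
  have h2 := h1.mul_left (2 * Real.pi * Complex.I * T / w)
  convert! h2 using 1
  · ext k
    simp only [Function.comp_apply, Equiv.neg_apply]
    rw [hpc, hqc]
    have h3 := hα k
    have h4 := Complex.I_ne_zero
    field_simp
  · rw [sub_zero, Complex.real_smul, Complex.ofReal_inv]
    have hcot : Complex.cot (Real.pi * α) + Complex.I = 2 * Complex.I / w := by
      have hs : Complex.exp (-(2 * Real.pi * Complex.I * α)) =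
        Complex.exp (-(Real.pi * α) * Complex.I) * Complex.exp (-(Real.pi * α) * Complex.I) := by
        rw [← Complex.exp_add]; congr 1; ring
      have hinv : Complex.exp (Real.pi * α * Complex.I) * Complex.exp (-(Real.pi * α) * Complex.I)
          = 1 := by
        rw [← Complex.exp_add]; simp
      rw [hw, hs] at hw0
      rw [hw, hs, Complex.cot_eq_cos_div_sin, Complex.cos, Complex.sin]
      set x := Complex.exp (Real.pi * α * Complex.I)
      set y := Complex.exp (-(Real.pi * α) * Complex.I)
      have hxy : y - x ≠ 0 := by
        intro h
        apply hw0
        rw [← hinv]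
        linear_combination (-y) * h
      have hI := Complex.I_sq
      have h5 : (x + y) / 2 / ((y - x) * Complex.I / 2) + Complex.I =
          2 * x / ((y - x) * Complex.I) := by
        field_simp
        linear_combination (y - x) * hI
      rw [h5, div_eq_div_iff (mul_ne_zero hxy Complex.I_ne_zero) hw0]
      linear_combination (-2 * y) * hinv - 2 * (y - x) * hI
    rw [hcot]
    field_simp

/-- Mittag-Leffler expansion of the cotangent: pairing `k` with `-k` yields its terms. The symmetric
range is essential, since the series does not converge absolutely. -/
theorem tendsto_sum_inv_add {α : ℂ} (hα : ∀ k : ℤ, (k : ℂ) + α ≠ 0) :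
    Tendsto (fun N : ℕ => ∑ k ∈ Finset.Icc (-(N : ℤ)) N, ((k : ℂ) + α)⁻¹) atTop
      (𝓝 (Real.pi * Complex.cot (Real.pi * α))) := by
  have hmem : α ∈ Complex.integerComplement := by
    rintro ⟨k, hk⟩
    apply hα (-k)
    rw [← hk]
    simp
  have h := (tendsto_logDeriv_euler_cot_sub hmem).add_const (1 / α)
  rw [sub_add_cancel] at h
  refine h.congr fun N => ?_
  induction N with
  | zero => simp
  | succ N ih =>
    rw [Finset.sum_range_succ, add_right_comm, ih, Nat.cast_add, Nat.cast_one,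
      Finset.Icc_succ_succ, Finset.sum_union (by simp), Finset.sum_pair (by lia), cotTerm]
    congr 1
    push_cast
    rw [← one_div, ← one_div]
    have h3 : -((N : ℂ) + 1) + α = α - (N + 1) := by ring
    rw [h3]
    have h4 : (N : ℂ) + 1 + α = α + (N + 1) := by ring
    rw [h4]

end Fourier

/-! ## The eigenfunctions -/

namespace LagHam

variable {n : ℕ} {T : ℝ} {θ : Fin n → ℝ}

theorem matOp_apply (M : Matrix (Fin n ⊕ Fin n) (Fin n ⊕ Fin n) ℝ) (x : Phase n)
    (i : Fin n ⊕ Fin n) : matOp M x i = ∑ k, (M i k : ℂ) * x k := by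
  change (Matrix.toEuclideanCLM (n := Fin n ⊕ Fin n) (𝕜 := ℂ) (M.map Complex.ofReal) x).ofLp i = _
  rw [Matrix.ofLp_toEuclideanCLM]
  rfl

theorem matOp_J_inl (x : Phase n) (j : Fin n) :
    matOp (Matrix.J (Fin n) ℝ) x (Sum.inl j) = -x (Sum.inr j) := by
  rw [matOp_apply, Fintype.sum_sum_type]
  simp [Matrix.J, Matrix.one_apply, apply_ite Complex.ofReal]

theorem matOp_J_inr (x : Phase n) (j : Fin n) :
    matOp (Matrix.J (Fin n) ℝ) x (Sum.inr j) = x (Sum.inl j) := by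
  rw [matOp_apply, Fintype.sum_sum_type]
  simp [Matrix.J, Matrix.one_apply, apply_ite Complex.ofReal]

theorem matOp_J_J (x : Phase n) :
    matOp (Matrix.J (Fin n) ℝ) (matOp (Matrix.J (Fin n) ℝ) x) = -x := by
  ext i
  rcases i with j | j
  · rw [matOp_J_inl, matOp_J_inr]; rfl
  · rw [matOp_J_inr, matOp_J_inl]; rfl

theorem opJ_opJ (f : L2 n T) : opJ n T (opJ n T f) = -f := by
  apply Lp.ext
  filter_upwards [coeFn_mulOp (fun _ => Matrix.J (Fin n) ℝ) continuousOn_const (opJ n T f),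
    coeFn_mulOp (T := T) (fun _ => Matrix.J (Fin n) ℝ) continuousOn_const f, Lp.coeFn_neg f]
    with t h1 h2 h3
  rw [h3, Pi.neg_apply, ← matOp_J_J (f t), ← h2]
  exact h1

theorem inner_eigFun (j : Fin n) (k : ℤ) (t : ℝ) (x : Phase n) :
    inner ℂ (eigFun T θ j k t) x = (Real.cos (eigVal T θ j k * t) : ℂ) * x (Sum.inl j) +
      (Real.sin (eigVal T θ j k * t) : ℂ) * x (Sum.inr j) := by
  rw [eigFun, inner_add_left, inner_smul_left, inner_smul_left, EuclideanSpace.inner_single_left,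
    EuclideanSpace.inner_single_left, Complex.conj_ofReal, Complex.conj_ofReal]
  simp

theorem eigFun_inl (j : Fin n) (k : ℤ) (t : ℝ) (i : Fin n) :
    eigFun T θ j k t (Sum.inl i) = if i = j then (Real.cos (eigVal T θ j k * t) : ℂ) else 0 := by
  simp [eigFun]

theorem eigFun_inr (j : Fin n) (k : ℤ) (t : ℝ) (i : Fin n) :
    eigFun T θ j k t (Sum.inr i) = if i = j then (Real.sin (eigVal T θ j k * t) : ℂ) else 0 := by
  simp [eigFun]

/-- The eigenfunction `e_{j,k}` as an element of the Hilbert space. -/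
noncomputable def eigVec (T : ℝ) (θ : Fin n → ℝ) (p : Fin n × ℤ) : L2 n T :=
  (memLp_eigFun T θ p.1 p.2).toLp _

theorem coeFn_eigVec (p : Fin n × ℤ) : eigVec T θ p =ᵐ[vol T] eigFun T θ p.1 p.2 :=
  (memLp_eigFun T θ p.1 p.2).coeFn_toLp

theorem inner_eigVec (p : Fin n × ℤ) (z : L2 n T) :
    inner ℂ (eigVec T θ p) z = ∫ t, ((Real.cos (eigVal T θ p.1 p.2 * t) : ℂ) * z t (Sum.inl p.1) +
      (Real.sin (eigVal T θ p.1 p.2 * t) : ℂ) * z t (Sum.inr p.1)) ∂(vol T) := by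
  rw [MeasureTheory.L2.inner_def]
  apply integral_congr_ae
  filter_upwards [coeFn_eigVec (T := T) (θ := θ) p] with t ht
  rw [ht, inner_eigFun]

theorem integral_vol_eq {E : Type*} [NormedAddCommGroup E] [NormedSpace ℝ E] (hT : 0 < T)
    (f : ℝ → E) : ∫ t, f t ∂(vol T) = ∫ t in 0..T, f t := by
  rw [intervalIntegral.integral_of_le hT.le, integral_Icc_eq_integral_Ioc]

/-- Different `j` occupy different coordinates. For equal `j` the shift `θ j` cancels and the
integrand is `cos ((k - l) π t / T)`. -/
theorem inner_eigVec_eigVec (hT : 0 < T) (p q : Fin n × ℤ) :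
    inner ℂ (eigVec T θ p) (eigVec T θ q) = if p = q then (T : ℂ) else 0 := by
  obtain ⟨i, k⟩ := p
  obtain ⟨j, l⟩ := q
  have h1 : inner ℂ (eigVec T θ (i, k)) (eigVec T θ (j, l)) = ∫ t in 0..T,
      ((if i = j then Real.cos ((eigVal T θ i k - eigVal T θ j l) * t) else 0 : ℝ) : ℂ) := by
    rw [inner_eigVec, ← integral_vol_eq hT]
    apply integral_congr_ae
    filter_upwards [coeFn_eigVec (T := T) (θ := θ) (j, l)] with t ht
    rw [ht, eigFun_inl, eigFun_inr, sub_mul, Real.cos_sub]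
    split_ifs <;> push_cast <;> ring
  rw [h1, intervalIntegral.integral_ofReal]
  by_cases hij : i = j
  · subst hij
    simp only [if_true, Prod.mk.injEq, true_and]
    by_cases hkl : k = l
    · subst hkl
      simp
    · have hkl' : ((k : ℝ) - l) ≠ 0 := sub_ne_zero.2 (by exact_mod_cast hkl)
      have h2 : eigVal T θ i k - eigVal T θ i l = (k - l) * Real.pi / T := by
        simp only [eigVal]
        ring
      have h3 : (k - l) * Real.pi / T ≠ 0 := by
        have := Real.pi_ne_zero
        positivity
      rw [if_neg hkl, h2, intervalIntegral.integral_comp_mul_left (fun x => Real.cos x) h3,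
        integral_cos, div_mul_cancel₀ _ hT.ne', mul_zero, Real.sin_zero]
      have := Real.sin_int_mul_pi (k - l)
      push_cast at this
      rw [this]
      simp
  · simp [hij]

theorem hasDerivAt_eigFun (j : Fin n) (k : ℤ) (t : ℝ) :
    HasDerivAt (eigFun T θ j k)
      ((eigVal T θ j k : ℂ) • matOp (Matrix.J (Fin n) ℝ) (eigFun T θ j k t)) t := by
  have h1 : HasDerivAt (fun t => eigVal T θ j k * t) (eigVal T θ j k) t := by
    simpa using (hasDerivAt_id t).const_mul (eigVal T θ j k)
  have hc := h1.cos.ofReal_comp.smul_const (EuclideanSpace.single (Sum.inl j) 1 : Phase n)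
  have hs := h1.sin.ofReal_comp.smul_const (EuclideanSpace.single (Sum.inr j) 1 : Phase n)
  convert! hc.add hs using 1
  ext i
  rcases i with i | i
  · rw [PiLp.smul_apply, matOp_J_inl, eigFun_inr]
    simp
    split_ifs <;> ring
  · rw [PiLp.smul_apply, matOp_J_inr, eigFun_inl]
    simp
    split_ifs <;> ring

theorem continuous_eigFun (j : Fin n) (k : ℤ) : Continuous (eigFun T θ j k) := by
  unfold eigFun
  fun_prop

theorem isPrimitive_eigFun (p : Fin n × ℤ) :
    IsPrimitive (eigFun T θ p.1 p.2)
      (opJ n T ((eigVal T θ p.1 p.2 : ℂ) • eigVec T θ p)) := by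
  intro t ht
  have h1 : ∫ s in 0..t, (opJ n T ((eigVal T θ p.1 p.2 : ℂ) • eigVec T θ p)) s =
      ∫ s in 0..t, (eigVal T θ p.1 p.2 : ℂ) •
        matOp (Matrix.J (Fin n) ℝ) (eigFun T θ p.1 p.2 s) := by
    apply intervalIntegral.integral_congr_ae
    have h2 : ∀ᵐ s ∂(vol T), (opJ n T ((eigVal T θ p.1 p.2 : ℂ) • eigVec T θ p)) s =
        (eigVal T θ p.1 p.2 : ℂ) • matOp (Matrix.J (Fin n) ℝ) (eigFun T θ p.1 p.2 s) := by
      filter_upwards [coeFn_mulOp (T := T) (fun _ => Matrix.J (Fin n) ℝ) continuousOn_const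
        ((eigVal T θ p.1 p.2 : ℂ) • eigVec T θ p),
        Lp.coeFn_smul (eigVal T θ p.1 p.2 : ℂ) (eigVec T θ p),
        coeFn_eigVec (T := T) (θ := θ) p] with s h1 h2 h3
      rw [opJ, h1, h2, Pi.smul_apply, h3, map_smul]
    rw [ae_restrict_iff' measurableSet_Icc] at h2
    filter_upwards [h2] with s hs hst
    rw [Set.uIoc_of_le ht.1] at hst
    exact hs ⟨hst.1.le, hst.2.trans ht.2⟩
  rw [h1, intervalIntegral.integral_eq_sub_of_hasDerivAt (fun s _ => hasDerivAt_eigFun p.1 p.2 s)]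
  · abel
  · apply Continuous.intervalIntegrable
    have := continuous_eigFun (T := T) (θ := θ) p.1 p.2
    fun_prop

theorem eigVec_mem_hamGraph (hT : 0 < T) (p : Fin n × ℤ) :
    (eigVec T θ p, (eigVal T θ p.1 p.2 : ℂ) • eigVec T θ p) ∈
      hamGraph T (frameSpace (frameZero n)) (frameSpace (frameOne θ)) := by
  refine ⟨eigFun T θ p.1 p.2, _, coeFn_eigVec p, isPrimitive_eigFun p, ?_, ?_, ?_⟩
  · apply Submodule.subset_span
    refine ⟨p.1, ?_⟩
    ext i
    rcases i with i | i
    · rw [eigFun_inl]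
      simp [frameZero, Matrix.one_apply, apply_ite Complex.ofReal]
    · rw [eigFun_inr]
      simp [frameZero]
  -- At `t = T` the angle is `θ_j + k π`, so the value is the `j`-th column of the frame up to the
  -- sign `(-1)^k`.
  · have h1 : eigFun T θ p.1 p.2 T = ((-1 : ℂ) ^ p.2) •
        (WithLp.toLp 2 fun i => (frameOne θ i p.1 : ℂ)) := by
      have h2 : eigVal T θ p.1 p.2 * T = θ p.1 + p.2 * Real.pi := by
        rw [eigVal]
        field_simp
      ext i
      rcases i with i | i
      · rw [eigFun_inl, h2, Real.cos_add_int_mul_pi]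
        by_cases h : i = p.1
        · subst h
          simp [frameOne]
        · simp [frameOne, h]
      · rw [eigFun_inr, h2, Real.sin_add_int_mul_pi]
        by_cases h : i = p.1
        · subst h
          simp [frameOne]
        · simp [frameOne, h]
    rw [h1]
    exact Submodule.smul_mem _ _ (Submodule.subset_span ⟨p.1, rfl⟩)
  · rw [opJ_opJ, neg_neg]

/-- The resolvent of `A` at a bounded operator, applied to an eigenfunction of `A`. -/
theorem boundedInverse_apply_eigVec (hT : 0 < T) {K R : L2 n T →L[ℂ] L2 n T}
    (hR : IsBoundedInverse (subBounded (normalA T θ) K) R) (p : Fin n × ℤ) :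
    R ((eigVal T θ p.1 p.2 : ℂ) • eigVec T θ p - K (eigVec T θ p)) = eigVec T θ p := by
  have h1 : (eigVec T θ p, (eigVal T θ p.1 p.2 : ℂ) • eigVec T θ p) ∈ (normalA T θ).graph := by
    rw [normalA, hamOp_graph hT]
    exact eigVec_mem_hamGraph hT p
  rw [LinearPMap.mem_graph_iff] at h1
  obtain ⟨y, hy1, hy2⟩ := h1
  have h2 := hR.2 y
  have h3 : subBounded (normalA T θ) K y = normalA T θ y - K (y : L2 n T) := rfl
  rw [h3, hy2, hy1] at h2
  exact h2

theorem orthonormal_eigVec (hT : 0 < T) :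
    Orthonormal ℂ fun p : Fin n × ℤ => ((Real.sqrt T : ℂ)⁻¹) • eigVec T θ p := by
  rw [orthonormal_iff_ite]
  intro p q
  rw [inner_smul_left, inner_smul_right, inner_eigVec_eigVec hT]
  split_ifs with h
  · have h1 : (Real.sqrt T : ℂ) ≠ 0 := by exact_mod_cast (Real.sqrt_pos.2 hT).ne'
    have h2 : (Real.sqrt T : ℂ) * Real.sqrt T = T := by exact_mod_cast Real.mul_self_sqrt hT.le
    rw [map_inv₀, Complex.conj_ofReal, ← h2]
    field_simp
  · simp

/-- The conditions decouple into one completeness problem for each coordinate pair `(j, n + j)`. -/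
theorem eq_zero_of_forall_inner_eigVec (hT : 0 < T) {z : L2 n T}
    (h : ∀ p, inner ℂ (eigVec T θ p) z = 0) : z = 0 := by
  have hcoord (i : Fin n ⊕ Fin n) : MemLp (fun t => z t i) 2 (vol T) :=
    (EuclideanSpace.proj (𝕜 := ℂ) i).comp_memLp' (Lp.memLp z)
  have key (j : Fin n) := ae_eq_zero_of_forall_integral_cos_add_sin hT (θ j)
    (hcoord (Sum.inl j)) (hcoord (Sum.inr j)) (fun k => by
      have h1 := h (j, k)
      rw [inner_eigVec] at h1
      rw [← h1]
      congr 1 with t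
      have h2 : ((θ j + k * Real.pi) / T * t : ℂ) = ((eigVal T θ j k * t : ℝ) : ℂ) := by
        rw [eigVal]; push_cast; ring
      rw [h2, Complex.ofReal_cos, Complex.ofReal_sin])
  apply Lp.ext
  have h3 : ∀ᵐ t ∂(vol T), ∀ j, z t (Sum.inl j) = 0 ∧ z t (Sum.inr j) = 0 := by
    rw [ae_all_iff]
    intro j
    filter_upwards [(key j).1, (key j).2] with t h1 h2
    exact ⟨h1, h2⟩
  filter_upwards [h3, Lp.coeFn_zero (Phase n) 2 (vol T)] with t h1 h2
  rw [h2]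
  ext i
  rcases i with j | j
  · exact (h1 j).1
  · exact (h1 j).2

/-- The normalized eigenfunctions of `A` as a Hilbert basis. -/
noncomputable def eigBasis (hT : 0 < T) (θ : Fin n → ℝ) : HilbertBasis (Fin n × ℤ) ℂ (L2 n T) :=
  HilbertBasis.mkOfOrthogonalEqBot (orthonormal_eigVec (θ := θ) hT) (by
    rw [Submodule.eq_bot_iff]
    intro z hz
    apply eq_zero_of_forall_inner_eigVec (θ := θ) hT
    intro p
    have h1 := (Submodule.mem_orthogonal _ _).1 hz _ (Submodule.subset_span ⟨p, rfl⟩)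
    rw [inner_smul_left, mul_eq_zero] at h1
    refine h1.resolve_left ?_
    have : (Real.sqrt T : ℂ) ≠ 0 := by exact_mod_cast (Real.sqrt_pos.2 hT).ne'
    simpa using this)

theorem eigBasis_apply (hT : 0 < T) (p : Fin n × ℤ) :
    eigBasis hT θ p = ((Real.sqrt T : ℂ)⁻¹) • eigVec T θ p := by
  rw [eigBasis, HilbertBasis.coe_mkOfOrthogonalEqBot]

/-- The indices of the eigenfunctions in the range of the projection `P_N`. -/
noncomputable def eigIndex (n N : ℕ) : Finset (Fin n × ℤ) := Finset.univ ×ˢ Finset.Icc (-(N : ℤ)) N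

theorem eigIndex_mono : Monotone (eigIndex n) := by
  intro a b hab
  apply Finset.product_subset_product le_rfl
  apply Finset.Icc_subset_Icc <;> lia

theorem exists_mem_eigIndex (p : Fin n × ℤ) : ∃ N, p ∈ eigIndex n N := by
  refine ⟨p.2.natAbs, ?_⟩
  simp only [eigIndex, Finset.mem_product, Finset.mem_univ, Finset.mem_Icc, true_and]
  lia

theorem eigSpan_eq (hT : 0 < T) (N : ℕ) :
    eigSpan T θ N = Submodule.span ℂ (eigBasis hT θ '' eigIndex n N) := by
  have hs : (Real.sqrt T : ℂ) ≠ 0 := by exact_mod_cast (Real.sqrt_pos.2 hT).ne'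
  apply le_antisymm
  · rw [eigSpan, Submodule.span_le]
    rintro _ ⟨p, rfl⟩
    have h1 : eigBasis hT θ (p.1, (p.2 : ℤ)) ∈ Submodule.span ℂ (eigBasis hT θ '' eigIndex n N) := by
      apply Submodule.subset_span
      refine ⟨_, ?_, rfl⟩
      simp [eigIndex]
    have h2 := Submodule.smul_mem _ (Real.sqrt T : ℂ) h1
    rw [eigBasis_apply, smul_smul, mul_inv_cancel₀ hs, one_smul] at h2
    exact h2
  · rw [Submodule.span_le]
    rintro _ ⟨p, hp, rfl⟩
    rw [eigBasis_apply]
    apply Submodule.smul_mem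
    apply Submodule.subset_span
    refine ⟨(p.1, ⟨p.2, ?_⟩), rfl⟩
    simpa [eigIndex] using hp

theorem isProjectionSequence_eigProj (hT : 0 < T) : IsProjectionSequence (eigProj T θ) where
  idempotent N := (eigSpan T θ N).isIdempotentElem_starProjection
  finite_rank N := by
    rw [eigProj, Submodule.range_starProjection]
    infer_instance
  range_mono k m hkm := by
    rw [eigProj, eigProj, Submodule.range_starProjection, Submodule.range_starProjection,
      eigSpan_eq hT, eigSpan_eq hT]
    exact Submodule.span_mono (Set.image_mono (eigIndex_mono hkm))
  strong_limit x := by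
    refine Submodule.starProjection_tendsto_self (eigSpan T θ) ?_ x ?_
    · intro k m hkm
      rw [eigSpan_eq hT, eigSpan_eq hT]
      exact Submodule.span_mono (Set.image_mono (eigIndex_mono hkm))
    · rw [← (eigBasis hT θ).dense_span]
      apply Submodule.topologicalClosure_mono
      rw [Submodule.span_le]
      rintro _ ⟨p, rfl⟩
      obtain ⟨N, hN⟩ := exists_mem_eigIndex p
      apply Submodule.mem_iSup_of_mem N
      rw [eigSpan_eq hT]
      exact Submodule.subset_span ⟨p, hN, rfl⟩

end LagHam

/-! ## The trace for a constant spectral parameter -/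

namespace LagHam

variable {n : ℕ} {T : ℝ} {θ : Fin n → ℝ}

/-- Because `J² = -1`, the map `(a, b) ↦ a (1 - i J) / 2 + b (1 + i J) / 2` is a continuous ring
homomorphism. It sends `(i z, -i z)` to `z J`, and `exp` commutes with it. -/
theorem exp_smul_J (z : ℂ) : NormedSpace.exp (z • Matrix.J (Fin n) ℂ) =
    Complex.cos z • (1 : Matrix (Fin n ⊕ Fin n) (Fin n ⊕ Fin n) ℂ) +
      Complex.sin z • Matrix.J (Fin n) ℂ := by
  set J := Matrix.J (Fin n) ℂ
  have hJ : J * J = -1 := Matrix.J_squared _ _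
  let f : ℂ × ℂ →+* Matrix (Fin n ⊕ Fin n) (Fin n ⊕ Fin n) ℂ :=
    { toFun := fun p => ((p.1 + p.2) / 2) • (1 : Matrix (Fin n ⊕ Fin n) (Fin n ⊕ Fin n) ℂ) +
        (-(Complex.I * (p.1 - p.2) / 2)) • J
      map_one' := by simp
      map_zero' := by simp
      map_add' := fun p q => by
        simp only [Prod.fst_add, Prod.snd_add]
        module
      map_mul' := fun p q => by
        simp only [Prod.fst_mul, Prod.snd_mul, mul_add, add_mul, smul_mul_smul_comm, hJ, mul_one,
          one_mul, smul_neg]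
        rw [← sub_eq_zero]
        have hI := Complex.I_sq
        match_scalars
        · linear_combination ((p.1 - p.2) * (q.1 - q.2) / 4) * hI
        · ring }
  have hf : Continuous f := by
    change Continuous fun p : ℂ × ℂ =>
      ((p.1 + p.2) / 2) • (1 : Matrix (Fin n ⊕ Fin n) (Fin n ⊕ Fin n) ℂ) +
        (-(Complex.I * (p.1 - p.2) / 2)) • J
    fun_prop
  let _ : NormedRing (Matrix (Fin n ⊕ Fin n) (Fin n ⊕ Fin n) ℂ) := Matrix.linftyOpNormedRing
  have h := NormedSpace.map_exp f hf (z * Complex.I, -z * Complex.I)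
  have h1 : f (z * Complex.I, -z * Complex.I) = z • J := by
    change (_ : ℂ) • _ + (_ : ℂ) • J = _
    have hI := Complex.I_sq
    match_scalars
    · ring
    · linear_combination (-z) * hI
  have h2 : NormedSpace.exp ((z * Complex.I, -z * Complex.I) : ℂ × ℂ) =
      (Complex.exp (z * Complex.I), Complex.exp (-z * Complex.I)) := by
    ext
    · rw [Prod.fst_exp, Complex.exp_eq_exp_ℂ]
    · rw [Prod.snd_exp, Complex.exp_eq_exp_ℂ]
  rw [h1, h2] at h
  refine h.symm.trans ?_
  change (_ : ℂ) • _ + (_ : ℂ) • J = _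
  dsimp only
  rw [Complex.cos, Complex.sin]
  congr 2
  ring

section Conj

variable (ν : ℂ) (t : ℝ) (D : Matrix (Fin n ⊕ Fin n) (Fin n ⊕ Fin n) ℝ) (j : Fin n)

theorem conjExp_eq : conjExp ν t D =
    (Complex.cos (ν * t) • (1 : Matrix (Fin n ⊕ Fin n) (Fin n ⊕ Fin n) ℂ) -
      Complex.sin (ν * t) • Matrix.J (Fin n) ℂ) * D.map Complex.ofReal *
    (Complex.cos (ν * t) • (1 : Matrix (Fin n ⊕ Fin n) (Fin n ⊕ Fin n) ℂ) +
      Complex.sin (ν * t) • Matrix.J (Fin n) ℂ) := by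
  rw [conjExp, exp_smul_J, exp_smul_J, Complex.cos_neg, Complex.sin_neg, neg_smul, sub_eq_add_neg]

theorem J_mul_inl (M : Matrix (Fin n ⊕ Fin n) (Fin n ⊕ Fin n) ℂ) (i : Fin n ⊕ Fin n) :
    (Matrix.J (Fin n) ℂ * M) (Sum.inl j) i = -M (Sum.inr j) i := by
  rw [Matrix.mul_apply, Fintype.sum_sum_type]
  simp [Matrix.J, Matrix.one_apply]

theorem mul_J_inl (M : Matrix (Fin n ⊕ Fin n) (Fin n ⊕ Fin n) ℂ) (i : Fin n ⊕ Fin n) :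
    (M * Matrix.J (Fin n) ℂ) i (Sum.inl j) = M i (Sum.inr j) := by
  rw [Matrix.mul_apply, Fintype.sum_sum_type]
  simp [Matrix.J, Matrix.one_apply]

theorem mul_J_inr (M : Matrix (Fin n ⊕ Fin n) (Fin n ⊕ Fin n) ℂ) (i : Fin n ⊕ Fin n) :
    (M * Matrix.J (Fin n) ℂ) i (Sum.inr j) = -M i (Sum.inl j) := by
  rw [Matrix.mul_apply, Fintype.sum_sum_type]
  simp [Matrix.J, Matrix.one_apply]

/-- The mean of the two diagonal entries of the `j`-th block. -/
noncomputable def meanPart : ℂ := (D (Sum.inl j) (Sum.inl j) + D (Sum.inr j) (Sum.inr j)) / 2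

/-- The coefficient of `exp (2 i λ t)` in `⟨e^{λJt} e_j, D e^{λJt} e_j⟩`. -/
noncomputable def posPart : ℂ := ((D (Sum.inl j) (Sum.inl j) - D (Sum.inr j) (Sum.inr j)) / 2 -
  Complex.I * D (Sum.inl j) (Sum.inr j)) / 2

/-- The coefficient of `exp (-2 i λ t)` in `⟨e^{λJt} e_j, D e^{λJt} e_j⟩`. -/
noncomputable def negPart : ℂ := ((D (Sum.inl j) (Sum.inl j) - D (Sum.inr j) (Sum.inr j)) / 2 +
  Complex.I * D (Sum.inl j) (Sum.inr j)) / 2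

variable {D}

/-- Double-angle formulas; symmetry of `D` merges the two off-diagonal terms. -/
theorem quadratic_eq (hD : D.IsSymm) (z : ℂ) :
    Complex.cos z * (Complex.cos z * D (Sum.inl j) (Sum.inl j) +
        Complex.sin z * D (Sum.inl j) (Sum.inr j)) +
      Complex.sin z * (Complex.cos z * D (Sum.inr j) (Sum.inl j) +
        Complex.sin z * D (Sum.inr j) (Sum.inr j)) =
    meanPart D j + posPart D j * Complex.exp (2 * Complex.I * z) +
      negPart D j * Complex.exp (-(2 * Complex.I * z)) := by
  rw [hD.apply (Sum.inl j) (Sum.inr j), meanPart, posPart, negPart, Complex.cos, Complex.sin]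
  have h1 : Complex.exp (2 * Complex.I * z) = Complex.exp (z * Complex.I) ^ 2 := by
    rw [← Complex.exp_nat_mul]; congr 1; push_cast; ring
  have h2 : Complex.exp (-(2 * Complex.I * z)) = Complex.exp (-z * Complex.I) ^ 2 := by
    rw [← Complex.exp_nat_mul]; congr 1; push_cast; ring
  have h3 : Complex.exp (z * Complex.I) * Complex.exp (-z * Complex.I) = 1 := by
    rw [← Complex.exp_add]; simp
  rw [h1, h2]
  set x := Complex.exp (z * Complex.I)
  set y := Complex.exp (-z * Complex.I)
  set a : ℂ := Complex.ofReal (D (Sum.inl j) (Sum.inl j))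
  set b : ℂ := Complex.ofReal (D (Sum.inl j) (Sum.inr j))
  set c : ℂ := Complex.ofReal (D (Sum.inr j) (Sum.inr j))
  have hI := Complex.I_sq
  linear_combination ((a + c) / 2) * h3 + (c * (y - x) ^ 2 / 4) * hI

theorem conjExp_inl_inl (hD : D.IsSymm) : conjExp ν t D (Sum.inl j) (Sum.inl j) =
    meanPart D j + posPart D j * Complex.exp (2 * Complex.I * (ν * t)) +
      negPart D j * Complex.exp (-(2 * Complex.I * (ν * t))) := by
  rw [← quadratic_eq j hD, conjExp_eq]
  simp only [mul_add, Matrix.add_apply, Matrix.mul_smul, Matrix.smul_apply, mul_J_inl, sub_mul,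
    Matrix.sub_apply, Matrix.smul_mul, J_mul_inl, one_mul, mul_one, Matrix.map_apply, smul_eq_mul]
  ring

/-- As a function of `ν t`, this entry is half the derivative of the diagonal entry in
`conjExp_inl_inl`. -/
theorem conjExp_inl_inr (hD : D.IsSymm) : conjExp ν t D (Sum.inl j) (Sum.inr j) =
    Complex.I * (posPart D j * Complex.exp (2 * Complex.I * (ν * t))) -
      Complex.I * (negPart D j * Complex.exp (-(2 * Complex.I * (ν * t)))) := by
  rw [conjExp_eq]
  simp only [mul_add, Matrix.add_apply, Matrix.mul_smul, Matrix.smul_apply, mul_J_inr, sub_mul,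
    Matrix.sub_apply, Matrix.smul_mul, J_mul_inl, one_mul, mul_one, Matrix.map_apply, smul_eq_mul]
  rw [hD.apply (Sum.inl j) (Sum.inr j), posPart, negPart, Complex.cos, Complex.sin]
  set z := ν * t
  have h1 : Complex.exp (2 * Complex.I * z) = Complex.exp (z * Complex.I) ^ 2 := by
    rw [← Complex.exp_nat_mul]; congr 1; push_cast; ring
  have h2 : Complex.exp (-(2 * Complex.I * z)) = Complex.exp (-z * Complex.I) ^ 2 := by
    rw [← Complex.exp_nat_mul]; congr 1; push_cast; ring
  rw [h1, h2]
  set x := Complex.exp (z * Complex.I)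
  set y := Complex.exp (-z * Complex.I)
  set a : ℂ := Complex.ofReal (D (Sum.inl j) (Sum.inl j))
  set b : ℂ := Complex.ofReal (D (Sum.inl j) (Sum.inr j))
  set c : ℂ := Complex.ofReal (D (Sum.inr j) (Sum.inr j))
  have hI := Complex.I_sq
  linear_combination (b * (x ^ 2 + y ^ 2) / 2 - b * (y - x) ^ 2 / 4) * hI

end Conj

theorem inner_eigVec_mulOp {D : ℝ → Matrix (Fin n ⊕ Fin n) (Fin n ⊕ Fin n) ℝ}
    (hT : 0 < T) (hD : ContinuousOn D (Set.Icc 0 T)) (hDs : ∀ t ∈ Set.Icc 0 T, (D t).IsSymm)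
    (p : Fin n × ℤ) :
    inner ℂ (eigVec T θ p) (mulOp D hD (eigVec T θ p)) =
      ∫ t in 0..T, (meanPart (D t) p.1 +
        posPart (D t) p.1 * Complex.exp (2 * Complex.I * (eigVal T θ p.1 p.2 * t)) +
        negPart (D t) p.1 * Complex.exp (-(2 * Complex.I * (eigVal T θ p.1 p.2 * t)))) := by
  rw [inner_eigVec, ← integral_vol_eq hT]
  apply integral_congr_ae
  filter_upwards [coeFn_mulOp D hD (eigVec T θ p), coeFn_eigVec (T := T) (θ := θ) p,
    ae_restrict_mem measurableSet_Icc] with t h1 h2 ht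
  rw [h1, h2, ← quadratic_eq p.1 (hDs t ht), matOp_apply, matOp_apply, Fintype.sum_sum_type,
    Fintype.sum_sum_type]
  simp only [eigFun_inl, eigFun_inr, mul_ite, mul_zero, Finset.sum_ite_eq', Finset.mem_univ,
    if_true]
  push_cast
  ring

theorem tendsto_eigIndex : Tendsto (eigIndex n) atTop atTop :=
  tendsto_atTop_finset_of_monotone eigIndex_mono exists_mem_eigIndex

theorem tendsto_Icc_neg : Tendsto (fun N : ℕ => Finset.Icc (-(N : ℤ)) N) atTop atTop := by
  apply tendsto_atTop_finset_of_monotone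
  · intro a b hab
    apply Finset.Icc_subset_Icc <;> lia
  · intro k
    refine ⟨k.natAbs, ?_⟩
    rw [Finset.mem_Icc]
    lia

theorem tendsto_sum_resolvent_integral (hT : 0 < T) {ν : ℂ} {j : Fin n}
    (hν : ∀ k : ℤ, (eigVal T θ j k : ℂ) - ν ≠ 0) {a q r : ℝ → ℂ}
    (ha : ContinuousOn a (Set.Icc 0 T)) (hq : ContinuousOn q (Set.Icc 0 T))
    (hr : ContinuousOn r (Set.Icc 0 T)) :
    Tendsto (fun N : ℕ => ∑ k ∈ Finset.Icc (-(N : ℤ)) N, ((eigVal T θ j k : ℂ) - ν)⁻¹ * ((T : ℂ)⁻¹ *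
      ∫ t in 0..T, (a t + q t * Complex.exp (2 * Complex.I * (eigVal T θ j k * t)) +
        r t * Complex.exp (-(2 * Complex.I * (eigVal T θ j k * t)))))) atTop
      (𝓝 (Complex.cot (θ j - T * ν) * (∫ t in 0..T, (a t +
          q t * Complex.exp (2 * Complex.I * (ν * t)) +
          r t * Complex.exp (-(2 * Complex.I * (ν * t))))) +
        ∫ t in 0..T, (Complex.I * (q t * Complex.exp (2 * Complex.I * (ν * t))) -
          Complex.I * (r t * Complex.exp (-(2 * Complex.I * (ν * t))))))) := by
  have hTc : (T : ℂ) ≠ 0 := by exact_mod_cast hT.ne'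
  have hpi : (Real.pi : ℂ) ≠ 0 := by exact_mod_cast Real.pi_ne_zero
  have hint {f : ℝ → ℂ} (hf : ContinuousOn f (Set.Icc 0 T)) : IntervalIntegrable f volume 0 T := by
    apply ContinuousOn.intervalIntegrable
    rwa [Set.uIcc_of_le hT.le]
  -- This choice makes `λ_{j,k} - ν = π (k + α) / T`.
  set α : ℂ := (θ j - T * ν) / Real.pi with hα
  have hpα : Real.pi * α = θ j - T * ν := by
    rw [hα]; field_simp
  have hlam (k : ℤ) : (eigVal T θ j k : ℂ) = ν + Real.pi * (k + α) / T := by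
    rw [mul_add, hpα, eigVal]
    push_cast
    field_simp
    ring
  have hα0 (k : ℤ) : (k : ℂ) + α ≠ 0 := by
    intro h
    apply hν k
    rw [hlam, h]
    simp
  have hα0' (k : ℤ) : (k : ℂ) + -α ≠ 0 := by
    intro h
    apply hα0 (-k)
    push_cast
    linear_combination -h
  have hq' : ContinuousOn (fun t : ℝ => q t * Complex.exp (2 * Complex.I * (ν * t)))
      (Set.Icc 0 T) := by fun_prop
  have hr' : ContinuousOn (fun t : ℝ => r t * Complex.exp (-(2 * Complex.I * (ν * t))))
      (Set.Icc 0 T) := by fun_prop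
  have s1 := (tendsto_sum_inv_add hα0).mul_const (∫ t in 0..T, a t)
  have s2 := (hasSum_inv_mul_integral_exp hT hα0 hq').comp tendsto_Icc_neg
  -- The negative frequencies are summed with `-α` and `-k`. Since the cotangent is odd, subtracting
  -- this sum contributes `π (cot - i)`, against `π (cot + i)` from `s2`.
  have s3 := ((Equiv.neg ℤ).hasSum_iff.2 (hasSum_inv_mul_integral_exp hT hα0' hr')).comp
    tendsto_Icc_neg
  have hcn : Complex.cot (Real.pi * -α) = -Complex.cot (Real.pi * α) := by
    rw [mul_neg, Complex.cot_eq_cos_div_sin, Complex.cot_eq_cos_div_sin, Complex.cos_neg,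
      Complex.sin_neg, div_neg]
  rw [hcn] at s3
  have s := ((s1.add s2).sub s3).const_mul ((Real.pi : ℂ)⁻¹)
  rw [intervalIntegral.integral_add ((hint ha).add (hint hq')) (hint hr'),
    intervalIntegral.integral_add (hint ha) (hint hq'),
    intervalIntegral.integral_sub ((hint hq').const_mul _) ((hint hr').const_mul _),
    intervalIntegral.integral_const_mul, intervalIntegral.integral_const_mul]
  rw [hpα] at s
  convert! s using 1
  · ext N
    simp only [Function.comp_apply]
    rw [Finset.sum_mul, ← Finset.sum_add_distrib, ← Finset.sum_sub_distrib, Finset.mul_sum]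
    refine Finset.sum_congr rfl fun k _ => ?_
    have hka := hα0 k
    have e1 : ContinuousOn (fun t : ℝ => q t *
        Complex.exp (2 * Complex.I * (eigVal T θ j k * t))) (Set.Icc 0 T) := by fun_prop
    have e2 : ContinuousOn (fun t : ℝ => r t *
        Complex.exp (-(2 * Complex.I * (eigVal T θ j k * t)))) (Set.Icc 0 T) := by fun_prop
    rw [intervalIntegral.integral_add ((hint ha).add (hint e1)) (hint e2),
      intervalIntegral.integral_add (hint ha) (hint e1)]
    have e3 : ∀ t : ℝ, q t * Complex.exp (2 * Complex.I * (ν * t)) *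
        Complex.exp (2 * Real.pi * Complex.I * (k + α) * t / T) =
        q t * Complex.exp (2 * Complex.I * (eigVal T θ j k * t)) := by
      intro t
      rw [mul_assoc, ← Complex.exp_add, hlam]
      congr 2
      ring
    have e4 : ∀ t : ℝ, r t * Complex.exp (-(2 * Complex.I * (ν * t))) *
        Complex.exp (2 * Real.pi * Complex.I * ((-k : ℤ) + -α) * t / T) =
        r t * Complex.exp (-(2 * Complex.I * (eigVal T θ j k * t))) := by
      intro t
      rw [mul_assoc, ← Complex.exp_add, hlam]
      congr 2
      push_cast
      ring
    have e5 : (((-k : ℤ) : ℂ) + -α)⁻¹ = -((k : ℂ) + α)⁻¹ := by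
      rw [← inv_neg]
      congr 1
      push_cast
      ring
    simp only [Equiv.neg_apply, e3, e4, e5]
    have e6 : ((eigVal T θ j k : ℂ) - ν)⁻¹ = T / Real.pi * ((k : ℂ) + α)⁻¹ := by
      rw [hlam]
      field_simp
      ring
    rw [e6]
    field_simp
    ring
  · congr 1
    field_simp
    ring

/-- The conditional trace of `D (A - ν)⁻¹`, computed from the diagonal coefficients. -/
theorem tendsto_sum_resolvent_inner (hT : 0 < T) {ν : ℂ}
    (hν : ∀ p : Fin n × ℤ, (eigVal T θ p.1 p.2 : ℂ) - ν ≠ 0)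
    {D : ℝ → Matrix (Fin n ⊕ Fin n) (Fin n ⊕ Fin n) ℝ}
    (hD : ContinuousOn D (Set.Icc 0 T)) (hDs : ∀ t ∈ Set.Icc 0 T, (D t).IsSymm) :
    Tendsto (fun N => ∑ p ∈ eigIndex n N, ((eigVal T θ p.1 p.2 : ℂ) - ν)⁻¹ *
        inner ℂ (eigBasis hT θ p) (mulOp D hD (eigBasis hT θ p))) atTop
      (𝓝 ((∑ j : Fin n, Complex.cos (θ j - T * ν) / Complex.sin (θ j - T * ν) *
          ∫ t in 0..T, conjExp ν t (D t) (Sum.inl j) (Sum.inl j)) +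
        ∑ j : Fin n, ∫ t in 0..T, conjExp ν t (D t) (Sum.inl j) (Sum.inr j))) := by
  have hent (i k : Fin n ⊕ Fin n) : ContinuousOn (fun t => (D t i k : ℂ)) (Set.Icc 0 T) :=
    Complex.continuous_ofReal.comp_continuousOn
      (((continuous_apply_apply i k).comp_continuousOn hD))
  have h := tendsto_finsetSum (Finset.univ : Finset (Fin n)) fun j _ =>
    tendsto_sum_resolvent_integral hT (fun k => hν (j, k))
      (a := fun t => meanPart (D t) j) (q := fun t => posPart (D t) j)
      (r := fun t => negPart (D t) j)
      (((hent _ _).add (hent _ _)).div_const _)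
      (((((hent _ _).sub (hent _ _)).div_const _).sub
        (continuousOn_const.mul (hent _ _))).div_const _)
      (((((hent _ _).sub (hent _ _)).div_const _).add
        (continuousOn_const.mul (hent _ _))).div_const _)
  rw [Finset.sum_add_distrib] at h
  convert! h using 1
  · ext N
    rw [eigIndex, Finset.sum_product]
    refine Finset.sum_congr rfl fun j _ => Finset.sum_congr rfl fun k _ => ?_
    have h2 : (Real.sqrt T : ℂ) * Real.sqrt T = T := by exact_mod_cast Real.mul_self_sqrt hT.le
    rw [eigBasis_apply, map_smul, inner_smul_left, inner_smul_right, map_inv₀, Complex.conj_ofReal,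
      ← mul_assoc (Real.sqrt T : ℂ)⁻¹, ← mul_inv, h2, inner_eigVec_mulOp hT hD hDs]
  · have hcongr {f g : ℝ → ℂ} (hfg : ∀ t ∈ Set.Icc 0 T, f t = g t) :
        ∫ t in 0..T, f t = ∫ t in 0..T, g t := by
      apply intervalIntegral.integral_congr
      rwa [Set.uIcc_of_le hT.le]
    congr 2
    · refine Finset.sum_congr rfl fun j _ => ?_
      rw [Complex.cot_eq_cos_div_sin, hcongr fun t ht => conjExp_inl_inl ν t j (hDs t ht)]
    · refine Finset.sum_congr rfl fun j _ => ?_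
      rw [hcongr fun t ht => conjExp_inl_inr ν t j (hDs t ht)]

end LagHam

/-! ## Resolvents of bounded perturbations -/

namespace LagHam

variable {n : ℕ} {T : ℝ} {θ : Fin n → ℝ}

/-- Compares `R` with the resolvent at a freely chosen `ν`: the value `i` is always allowed, and for
`K = ν` the correction term vanishes. -/
theorem boundedInverse_apply_eigBasis (hT : 0 < T) {K R : L2 n T →L[ℂ] L2 n T}
    (hR : IsBoundedInverse (subBounded (normalA T θ) K) R) (ν : ℂ) {p : Fin n × ℤ}
    (hν : (eigVal T θ p.1 p.2 : ℂ) - ν ≠ 0) :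
    R (eigBasis hT θ p) = ((eigVal T θ p.1 p.2 : ℂ) - ν)⁻¹ •
      (eigBasis hT θ p + R (K (eigBasis hT θ p) - ν • eigBasis hT θ p)) := by
  have h1 := congrArg (fun z => ((Real.sqrt T : ℂ)⁻¹) • z) (boundedInverse_apply_eigVec hT hR p)
  rw [← map_smul, smul_sub, smul_comm, ← map_smul, ← eigBasis_apply hT] at h1
  rw [eq_inv_smul_iff₀ hν]
  nth_rewrite 2 [← h1]
  rw [← map_add, ← map_smul]
  congr 1
  module

/-- Were `ν` an eigenvalue, `R` would map `0` to an eigenvector, whose squared norm is `T`. -/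
theorem eigVal_sub_ne_zero (hT : 0 < T) {ν : ℂ} {R : L2 n T →L[ℂ] L2 n T}
    (hR : IsBoundedInverse (subBounded (normalA T θ) (ν • ContinuousLinearMap.id ℂ (L2 n T))) R)
    (p : Fin n × ℤ) : (eigVal T θ p.1 p.2 : ℂ) - ν ≠ 0 := by
  intro h
  have h1 := boundedInverse_apply_eigVec hT hR p
  rw [smul_apply, ContinuousLinearMap.id_apply, ← sub_smul, h, zero_smul,
    map_zero] at h1
  have h2 := inner_eigVec_eigVec (θ := θ) hT p p
  rw [← h1, inner_zero_left, if_pos rfl, eq_comm, Complex.ofReal_eq_zero] at h2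
  exact hT.ne' h2

theorem eigVal_sub_I_ne_zero (p : Fin n × ℤ) :
    (eigVal T θ p.1 p.2 : ℂ) - Complex.I ≠ 0 := by
  intro h
  simpa using congrArg Complex.im h

/-- For fixed `j` this is a series of inverse squares of linear terms in `k`. A term with `λ = ν` is
`0` by the convention `0⁻¹ = 0`, so no condition on `ν` is needed. -/
theorem summable_inv_eigVal_sub (hT : 0 < T) (ν : ℂ) :
    Summable fun p : Fin n × ℤ => ‖((eigVal T θ p.1 p.2 : ℂ) - ν)⁻¹‖ ^ 2 := by
  rw [summable_prod_of_nonneg (fun p => by positivity)]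
  refine ⟨fun j => ?_, (hasSum_fintype _).summable⟩
  have h1 := (EisensteinSeries.linear_right_summable ((θ j - T * ν) / Real.pi) 1
    (le_refl (2 : ℤ))).norm.mul_left (‖(T : ℂ) / Real.pi‖ ^ 2)
  refine h1.congr fun k => ?_
  have hTc : (T : ℂ) ≠ 0 := by exact_mod_cast hT.ne'
  have hpi : (Real.pi : ℂ) ≠ 0 := by exact_mod_cast Real.pi_ne_zero
  rw [← norm_pow, ← norm_pow, ← norm_mul]
  congr 1
  have h2 : (eigVal T θ j k : ℂ) - ν =
      Real.pi / T * ((1 : ℤ) * ((θ j - T * ν) / Real.pi) + k) := by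
    rw [eigVal]
    push_cast
    field_simp
    ring
  rw [h2, mul_inv, inv_div, mul_pow, zpow_ofNat, inv_pow]

/-- The resolvent of a bounded perturbation of `A` is a Hilbert-Schmidt operator. -/
theorem summable_norm_resolvent_sq (hT : 0 < T) {K R : L2 n T →L[ℂ] L2 n T}
    (hR : IsBoundedInverse (subBounded (normalA T θ) K) R) (D : L2 n T →L[ℂ] L2 n T) :
    Summable fun p => ‖(D ∘L R) (eigBasis hT θ p)‖ ^ 2 := by
  set G := ContinuousLinearMap.id ℂ (L2 n T) +
    R ∘L (K - Complex.I • ContinuousLinearMap.id ℂ (L2 n T))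
  refine Summable.of_nonneg_of_le (fun p => by positivity) (fun p => ?_)
    ((summable_inv_eigVal_sub (θ := θ) hT Complex.I).mul_left ((‖D‖ * ‖G‖) ^ 2))
  rw [← mul_pow]
  have h1 : (D ∘L R) (eigBasis hT θ p) =
      ((eigVal T θ p.1 p.2 : ℂ) - Complex.I)⁻¹ • D (G (eigBasis hT θ p)) := by
    rw [ContinuousLinearMap.comp_apply,
      boundedInverse_apply_eigBasis hT hR Complex.I (eigVal_sub_I_ne_zero p), map_smul]
    rfl
  rw [h1, norm_smul, mul_comm (‖D‖ * ‖G‖)]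
  gcongr
  calc ‖D (G (eigBasis hT θ p))‖ ≤ ‖D‖ * (‖G‖ * ‖eigBasis hT θ p‖) :=
        D.le_opNorm_of_le (G.le_opNorm _)
    _ = ‖D‖ * ‖G‖ := by rw [(eigBasis hT θ).orthonormal.1 p, mul_one]

theorem compressedTrace_eigProj (hT : 0 < T) (N : ℕ) (F : L2 n T →L[ℂ] L2 n T) :
    compressedTrace (eigProj T θ N) F =
      ∑ p ∈ eigIndex n N, inner ℂ (eigBasis hT θ p) (F (eigBasis hT θ p)) :=
  (eigBasis hT θ).compressedTrace_starProjection (eigIndex n N) (eigSpan_eq hT N) F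

/-- The conditional trace of `D (A - K)⁻¹` exists for bounded `K`. -/
theorem exists_hasConditionalTrace (hT : 0 < T) {K R : L2 n T →L[ℂ] L2 n T}
    (hR : IsBoundedInverse (subBounded (normalA T θ) K) R)
    {D : ℝ → Matrix (Fin n ⊕ Fin n) (Fin n ⊕ Fin n) ℝ}
    (hD : ContinuousOn D (Set.Icc 0 T)) (hDs : ∀ t ∈ Set.Icc 0 T, (D t).IsSymm) :
    ∃ c, HasConditionalTrace (eigProj T θ) (mulOp D hD ∘L R) c := by
  set F := mulOp D hD ∘L R with hF
  set b := eigBasis hT θ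
  set L := K - Complex.I • ContinuousLinearMap.id ℂ (L2 n T)
  set μ : Fin n × ℤ → ℂ := fun p => ((eigVal T θ p.1 p.2 : ℂ) - Complex.I)⁻¹
  have h1 := tendsto_sum_resolvent_inner hT (ν := Complex.I)
    (fun p => eigVal_sub_I_ne_zero (T := T) (θ := θ) p) hD hDs
  -- The correction `μ ⟨b, F (L b)⟩` with `F` moved to the left: `μ` and `‖F* b‖` are both square
  -- summable and `L` is bounded, so the sum converges absolutely.
  have h2 : Summable fun p => μ p * inner ℂ (F.adjoint (b p)) (L (b p)) := by
    have h3 := ((summable_inv_eigVal_sub (θ := θ) hT Complex.I).add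
      (b.summable_adjoint (summable_norm_resolvent_sq hT hR (mulOp D hD)))).mul_left ‖L‖
    refine Summable.of_norm_bounded h3 fun p => ?_
    have h4 : ‖inner ℂ (F.adjoint (b p)) (L (b p))‖ ≤ ‖F.adjoint (b p)‖ * ‖L‖ := by
      refine (norm_inner_le_norm _ _).trans ?_
      gcongr
      have := L.le_opNorm (b p)
      rwa [b.orthonormal.1 p, mul_one] at this
    rw [norm_mul]
    calc ‖μ p‖ * ‖inner ℂ (F.adjoint (b p)) (L (b p))‖
        ≤ ‖μ p‖ * (‖F.adjoint (b p)‖ * ‖L‖) := by gcongr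
      _ = ‖L‖ * (‖μ p‖ * ‖F.adjoint (b p)‖) := by ring
      _ ≤ ‖L‖ * (‖μ p‖ ^ 2 + ‖F.adjoint (b p)‖ ^ 2) := by
        gcongr
        nlinarith [sq_nonneg (‖μ p‖ - ‖F.adjoint (b p)‖), sq_nonneg (‖μ p‖ + ‖F.adjoint (b p)‖)]
  refine ⟨_, (h1.add (h2.hasSum.comp tendsto_eigIndex)).congr fun N => ?_⟩
  rw [compressedTrace_eigProj hT, Function.comp_apply, ← Finset.sum_add_distrib]
  refine Finset.sum_congr rfl fun p _ => ?_
  rw [ContinuousLinearMap.adjoint_inner_left, ← mul_add, ← inner_add_right, ← inner_smul_right]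
  congr 1
  rw [hF, ContinuousLinearMap.comp_apply, ContinuousLinearMap.comp_apply,
    boundedInverse_apply_eigBasis hT hR Complex.I (eigVal_sub_I_ne_zero p), map_smul, map_add]
  rfl

theorem HasConditionalTrace.neg {hT : 0 < T} {F : L2 n T →L[ℂ] L2 n T} {c : ℂ}
    (h : HasConditionalTrace (eigProj T θ) F c) :
    HasConditionalTrace (eigProj T θ) (-F) (-c) := by
  refine (Tendsto.neg h).congr fun N => ?_
  rw [compressedTrace_eigProj hT, compressedTrace_eigProj hT, ← Finset.sum_neg_distrib]
  simp

theorem hasConditionalTrace_calF_const (hT : 0 < T) {ν : ℂ}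
    (hinv : IsInvertible (subBounded (normalA T θ) (ν • ContinuousLinearMap.id ℂ (L2 n T))))
    {D : ℝ → Matrix (Fin n ⊕ Fin n) (Fin n ⊕ Fin n) ℝ}
    (hD : ContinuousOn D (Set.Icc 0 T)) (hDs : ∀ t ∈ Set.Icc 0 T, (D t).IsSymm) :
    HasConditionalTrace (eigProj T θ)
      (calF (normalA T θ) (ν • ContinuousLinearMap.id ℂ (L2 n T)) (mulOp D hD))
      ((∑ j : Fin n, Complex.cos (θ j - T * ν) / Complex.sin (θ j - T * ν) *
          ∫ t in 0..T, conjExp ν t (D t) (Sum.inl j) (Sum.inl j)) +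
        ∑ j : Fin n, ∫ t in 0..T, conjExp ν t (D t) (Sum.inl j) (Sum.inr j)) := by
  have hR := isBoundedInverse_boundedInverse hinv
  refine (tendsto_sum_resolvent_inner hT (eigVal_sub_ne_zero hT hR) hD hDs).congr fun N => ?_
  rw [compressedTrace_eigProj hT]
  refine Finset.sum_congr rfl fun p _ => ?_
  rw [← inner_smul_right, calF, ContinuousLinearMap.comp_apply,
    boundedInverse_apply_eigBasis hT hR ν (eigVal_sub_ne_zero hT hR p)]
  simp

end LagHam

/-! ### The conditional trace and determinant for the normal form -/

theorem mainTheorem6 (n : ℕ) (T : ℝ) (hT : 0 < T) (θ : Fin n → ℝ)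
    (hθ : ∀ j, -(Real.pi / 2) < θ j ∧ θ j ≤ Real.pi / 2) :
    -- the eigenprojections are admissible in the trace finite condition
    IsProjectionSequence (eigProj T θ) ∧
    -- the trace finite condition and the conditional trace for a constant spectral parameter
    (∀ (D : ℝ → Matrix (Fin n ⊕ Fin n) (Fin n ⊕ Fin n) ℝ)
      (hD : ContinuousOn D (Set.Icc 0 T)) (_hDs : ∀ t ∈ Set.Icc 0 T, (D t).IsSymm) (ν : ℂ),
      IsInvertible (subBounded (normalA T θ) (ν • ContinuousLinearMap.id ℂ (L2 n T))) →
        calF (normalA T θ) (ν • ContinuousLinearMap.id ℂ (L2 n T)) (mulOp D hD) ∈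
            traceFinite (eigProj T θ) ∧
          HasConditionalTrace (eigProj T θ)
            (calF (normalA T θ) (ν • ContinuousLinearMap.id ℂ (L2 n T)) (mulOp D hD))
            ((∑ j : Fin n, Complex.cos (θ j - T * ν) / Complex.sin (θ j - T * ν) *
                ∫ t in 0..T, conjExp ν t (D t) (Sum.inl j) (Sum.inl j)) +
              ∑ j : Fin n, ∫ t in 0..T, conjExp ν t (D t) (Sum.inl j) (Sum.inr j))) ∧
    -- the trace finite condition and the conditional determinant for a path of matrices
    (∀ (B D : ℝ → Matrix (Fin n ⊕ Fin n) (Fin n ⊕ Fin n) ℝ)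
      (hB : ContinuousOn B (Set.Icc 0 T)) (_hBs : ∀ t ∈ Set.Icc 0 T, (B t).IsSymm)
      (hD : ContinuousOn D (Set.Icc 0 T)) (_hDs : ∀ t ∈ Set.Icc 0 T, (D t).IsSymm),
      IsInvertible (subBounded (normalA T θ) (mulOp B hB)) →
        calF (normalA T θ) (mulOp B hB) (mulOp D hD) ∈ traceFinite (eigProj T θ) ∧
          ∃! d : ℂ, HasConditionalDet (eigProj T θ)
            (-calF (normalA T θ) (mulOp B hB) (mulOp D hD)) d) := by
  refine ⟨isProjectionSequence_eigProj hT, ?_, ?_⟩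
  · intro D hD hDs ν hinv
    have h := hasConditionalTrace_calF_const hT hinv hD hDs
    exact ⟨⟨(eigBasis hT θ).isHilbertSchmidt (summable_norm_resolvent_sq hT
      (isBoundedInverse_boundedInverse hinv) (mulOp D hD)), _, h⟩, h⟩
  · intro B D hB _ hD hDs hinv
    have hR := isBoundedInverse_boundedInverse hinv
    have hs := summable_norm_resolvent_sq hT hR (mulOp D hD)
    obtain ⟨c, hc⟩ := exists_hasConditionalTrace hT hR hD hDs
    refine ⟨⟨(eigBasis hT θ).isHilbertSchmidt hs, c, hc⟩, ?_⟩
    -- The determinant of `id - F` is that of `id + (-F)`, so the criterion is applied to `-F`.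
    have hs' : Summable fun p => ‖(-calF (normalA T θ) (mulOp B hB) (mulOp D hD))
        (eigBasis hT θ p)‖ ^ 2 :=
      hs.congr fun p => by rw [neg_apply, norm_neg]; rfl
    obtain ⟨d, hd⟩ := (eigBasis hT θ).exists_hasConditionalDet eigIndex_mono exists_mem_eigIndex
      (eigSpan T θ) (eigSpan_eq hT) hs' (HasConditionalTrace.neg (hT := hT) hc)
    exact ⟨d, hd, fun d' hd' => tendsto_nhds_unique hd' hd⟩
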